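/- Let $P$ be a finite poset and $\omega:P\to\mathbb N$ an injective map (a labelling); $(P,\omega)$ is called a labelled poset. For $k\ge 0$ let $e_k(P,\omega)$ be the number of surjective maps $\sigma:P\to\{1,\dots,k\}$ such that $\sigma(x)\ge\sigma(y)$ whenever $x\le y$, and $\sigma(x)>\sigma(y)$ whenever $x<y$ and $\omega(x)>\omega(y)$. The $E$-polynomial of $(P,\omega)$ is $$E(P,\omega)=\sum_{k=0}^{|P|}e_k(P,\omega)\,x^k\in\mathbb R[x],$$ so that $E(\emptyset)=1$ (for nonempty $P$ the term $k=0$ vanishes). A real polynomial is real-rooted if all its zeros are real. For nonzero real polynomials $f,g$ write $g\preceq f$ if $f$ and $g$ are real-rooted, $\deg f=\deg g+1=d$, and the zeros $\alpha_1\le\dots\le\alpha_d$ of $f$ and $\beta_1\le\dots\le\beta_{d-1}$ of $g$, listed with multiplicity, satisfy $$\alpha_1\le\beta_1\le\alpha_2\le\dots\le\beta_{d-1}\le\alpha_d .$$ Let $\mathscr I$ be the class of all finite labelled posets $(S,\mu)$ such that $E(S,\mu)$ is real-rooted and $E(S\setminus x,\mu)\preceq E(S,\mu)$ for every $x\in S$,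 where $S\setminus x$ denotes $S\setminus\{x\}$ with the inherited order and the restricted labelling. For labelled posets $(P,\omega)$ and $(Q,\nu)$, let $P\oplus Q$ (ordinal sum) be the disjoint union of $P$ and $Q$ in which the orders of $P$ and $Q$ are kept and every element of $P$ lies below every element of $Q$, and let $P\sqcup Q$ (disjoint union) be the disjoint union in which the orders of $P$ and $Q$ are kept and elements of $P$ are incomparable to elements of $Q$. Say that a labelling $\mu$ of $P\oplus Q$ or $P\sqcup Q$ is compatible with $\omega$ and $\nu$ if, for $x,y\in P$, $\omega(x)<\omega(y)$ implies $\mu(x)<\mu(y)$ and, for $x,y\in Q$, $\nu(x)<\nu(y)$ implies $\mu(x)<\mu(y)$. **Theorem.** The class $\mathscr I$ is closed under ordinal sum and disjoint union. That is, if $(P,\omega)\in\mathscr I$ and $(Q,\nu)\in\mathscr I$, then: 1. $(P\oplus Q,\mu)\in\mathscr I$ for every labelling $\mu=\omega\oplus_0\nu$, i.e. every compatible labelling $\mu$ of $P\oplus Q$ with $\mu(x)<\mu(y)$ for all $x\in P$, $y\in Q$; 2. $(P\oplus Q,\mu)\in\mathscr I$ for every labelling $\mu=\omega\oplus_1\nu$,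 i.e. every compatible labelling $\mu$ of $P\oplus Q$ with $\mu(y)<\mu(x)$ for all $x\in P$, $y\in Q$; 3. $(P\sqcup Q,\mu)\in\mathscr I$ for every labelling $\mu=\omega\sqcup\nu$, i.e. every compatible labelling $\mu$ of $P\sqcup Q$. -/

import Mathlib

open Polynomial

noncomputable section

namespace LabelledPoset

/-- A `(P, ω)`-partition with values in the `n`-element chain `Fin n` (which stands for
`{1, …, n}`): an order reversing map `σ` such that `σ x > σ y` whenever `x < y` and
`ω x > ω y`. -/
def IsPartition {P : Type*} [PartialOrder P] (ω : P → ℕ) {n : ℕ} (σ : P → Fin n) : Prop :=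
  (∀ x y : P, x ≤ y → σ y ≤ σ x) ∧ (∀ x y : P, x < y → ω y < ω x → σ y < σ x)

/-- `e_k(P, ω)`: the number of surjective `(P, ω)`-partitions onto a `k`-element chain. -/
def surjCount {P : Type*} [PartialOrder P] (ω : P → ℕ) (k : ℕ) : ℕ :=
  Nat.card {σ : P → Fin k // IsPartition ω σ ∧ Function.Surjective σ}

/-- The `E`-polynomial `∑ e_k(P, ω) x^k` of a finite labelled poset. The term `k = 0` vanishes
unless `P` is empty, and it makes the `E`-polynomial of the empty poset equal to `1`. -/
def EPoly {P : Type*} [PartialOrder P] (ω : P → ℕ) : ℝ[X] :=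
  ∑ k ∈ Finset.range (Nat.card P + 1), C (surjCount ω k : ℝ) * X ^ k

/-- All zeros of the real polynomial `f` are real. -/
def RealRooted (f : ℝ[X]) : Prop := f.Splits

/-- `g ⪯ f`: both polynomials are real-rooted, `deg f = deg g + 1 = d + 1`, and the zeros
`α 0 ≤ … ≤ α d` of `f` and `β 0 ≤ … ≤ β (d - 1)` of `g`, listed with multiplicity, satisfy
`α 0 ≤ β 0 ≤ α 1 ≤ … ≤ β (d - 1) ≤ α d`. -/
def Interlaces (g f : ℝ[X]) : Prop :=
  g ≠ 0 ∧ RealRooted g ∧ RealRooted f ∧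
    ∃ (d : ℕ) (α : Fin (d + 1) → ℝ) (β : Fin d → ℝ),
      f.natDegree = d + 1 ∧ g.natDegree = d ∧ Monotone α ∧ Monotone β ∧
      f.roots = Finset.univ.val.map α ∧ g.roots = Finset.univ.val.map β ∧
      ∀ i : Fin d, α i.castSucc ≤ β i ∧ β i ≤ α i.succ

/-- The restriction of a labelling of `P` to `P ∖ x`, with the inherited order. -/
def deleteLabel {P : Type*} (ω : P → ℕ) (x : P) : {y : P // y ≠ x} → ℕ :=
  fun y => ω y

/-- `(P, ω)` belongs to the class `𝓘`: it is a finite poset with an injective labelling, its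
`E`-polynomial is real-rooted, and deleting any element gives an `E`-polynomial that interlaces
it. -/
structure InClassI {P : Type*} [PartialOrder P] (ω : P → ℕ) : Prop where
  finite : Finite P
  injective : Function.Injective ω
  realRooted : RealRooted (EPoly ω)
  interlaces : ∀ x : P, Interlaces (EPoly (deleteLabel ω x)) (EPoly ω)

/-- `μ` is a labelling `ω ⊕₀ ν` of the ordinal sum `P ⊕ₗ Q` (in which all elements of `P` lie
below all elements of `Q`): it keeps the label orders on `P` and on `Q`, and labels in `P` are
smaller than labels in `Q`. -/
structure IsOrdinalSumLabelling₀ {P Q : Type*} (ω : P → ℕ) (ν : Q → ℕ) (μ : P ⊕ₗ Q → ℕ) :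
    Prop where
  injective : Function.Injective μ
  left : ∀ x y : P, ω x < ω y → μ (Sum.inlₗ x) < μ (Sum.inlₗ y)
  right : ∀ x y : Q, ν x < ν y → μ (Sum.inrₗ x) < μ (Sum.inrₗ y)
  left_lt_right : ∀ (x : P) (y : Q), μ (Sum.inlₗ x) < μ (Sum.inrₗ y)

/-- `μ` is a labelling `ω ⊕₁ ν` of the ordinal sum `P ⊕ₗ Q`: it keeps the label orders on `P`
and on `Q`, and labels in `Q` are smaller than labels in `P`. -/
structure IsOrdinalSumLabelling₁ {P Q : Type*} (ω : P → ℕ) (ν : Q → ℕ) (μ : P ⊕ₗ Q → ℕ) :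
    Prop where
  injective : Function.Injective μ
  left : ∀ x y : P, ω x < ω y → μ (Sum.inlₗ x) < μ (Sum.inlₗ y)
  right : ∀ x y : Q, ν x < ν y → μ (Sum.inrₗ x) < μ (Sum.inrₗ y)
  right_lt_left : ∀ (x : Q) (y : P), μ (Sum.inrₗ x) < μ (Sum.inlₗ y)

/-- `μ` is a labelling `ω ⊔ ν` of the disjoint union `P ⊕ Q` (in which elements of `P` and `Q`
are incomparable): it keeps the label orders on `P` and on `Q`. -/
structure IsDisjointUnionLabelling {P Q : Type*} (ω : P → ℕ) (ν : Q → ℕ) (μ : P ⊕ Q → ℕ) :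
    Prop where
  injective : Function.Injective μ
  left : ∀ x y : P, ω x < ω y → μ (Sum.inl x) < μ (Sum.inl y)
  right : ∀ x y : Q, ν x < ν y → μ (Sum.inr x) < μ (Sum.inr y)

end LabelledPoset

end

/-! For real-rooted polynomials with positive leading coefficients and degrees differing by one, `g
⪯ f` means that `f / g` maps the open upper half plane into itself (`UpperRatio.of_interlaces`,
`Interlaces.of_upperRatio`). In this form interlacing survives any operation that is linear in the
pair `(g, f)` and creates no zeros in the upper half plane, so it remains to see how `E` behaves
under the three constructions.

An ordinal sum with strict relations between the summands multiplies `E`-polynomials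
(`EPoly_of_strict`). With weak relations the top value of one part may also equal the bottom value
of the other, which gives the factor `(X + 1) / X` (`EPoly_of_weak`). Both cases leave the quotient
for `P ∖ x` and `P` unchanged, apart from one-point summands.

For a disjoint union, the functional `X ^ k ↦ m.choose k` turns `E` into the number of partitions
with values below `m`, and these numbers multiply. The corresponding bilinear operation on
polynomials is the diamond product (`chooseEval_diamond`, `EPoly_of_disjoint`). If one factor has
all its zeros in `[-1, 0]`, the product creates no zeros in the upper half plane
(`eval_diamond_ne_zero`, by Gauss–Lucas). The real zeros of `E` do lie there (`EPoly_root_mem`):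
splitting on incomparable pairs writes `E` as a sum over chains, and for a chain `E` is a product of
factors `X` and `X + 1`. -/

noncomputable section

namespace LabelledPoset

/-! ### Interlacing and the upper half plane -/

/-- The quotient `f / g` maps the open upper half plane into itself. -/
def UpperRatio (g f : ℝ[X]) : Prop :=
  ∀ z : ℂ, 0 < z.im → 0 < (aeval z f / aeval z g).im

theorem one_sub_I_mul (y : ℝ) :
    (1 - Complex.I * y : ℂ) = (√(1 + y ^ 2) : ℝ) * Complex.exp (-(Real.arctan y : ℝ) * Complex.I) := by
  have h : 0 < √(1 + y ^ 2) := by positivity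
  have h2 : -((Real.arctan y : ℝ) : ℂ) = ((-Real.arctan y : ℝ) : ℂ) := by push_cast; rfl
  rw [h2, Complex.exp_mul_I, ← Complex.ofReal_cos, ← Complex.ofReal_sin, Real.cos_neg,
    Real.sin_neg, Real.cos_arctan, Real.sin_arctan]
  apply Complex.ext
  · simp
    field_simp
  · simp
    field_simp

/-- With `u` the inverse of the imaginary part, the argument of the factor is `π / 2 - arctan ((t -
r) * u)`. The arctangent extends continuously to `u = 0`, the point at infinity, while `u → ∞`
approaches the real point `t`. -/
theorem upper_sub_eq (t u r : ℝ) (hu : 0 < u) :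
    ((t : ℂ) + Complex.I / u - r) = (√(1 + ((t - r) * u) ^ 2) / u : ℝ) * Complex.I *
      Complex.exp (-(Real.arctan ((t - r) * u) : ℝ) * Complex.I) := by
  have hu' : (u : ℂ) ≠ 0 := by exact_mod_cast hu.ne'
  have h := one_sub_I_mul ((t - r) * u)
  have h3 : ((t : ℂ) + Complex.I / u - r)
      = Complex.I / u * (1 - Complex.I * (((t - r) * u : ℝ) : ℂ)) := by
    push_cast
    field_simp
    linear_combination ((t - r) * u : ℂ) * Complex.I_sq
  rw [h3, h]
  push_cast
  ring

theorem exists_prod_upper_sub (s : Multiset ℝ) (t u : ℝ) (hu : 0 < u) :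
    ∃ R : ℝ, 0 < R ∧ (s.map fun r : ℝ => ((t : ℂ) + Complex.I / u - r)).prod =
      R * Complex.I ^ s.card *
        Complex.exp (-((s.map fun r => Real.arctan ((t - r) * u)).sum : ℝ) * Complex.I) := by
  induction s using Multiset.induction with
  | empty => exact ⟨1, one_pos, by simp⟩
  | cons a s ih =>
    obtain ⟨R, hR, h⟩ := ih
    refine ⟨√(1 + ((t - a) * u) ^ 2) / u * R, by positivity, ?_⟩
    rw [Multiset.map_cons, Multiset.prod_cons, h, upper_sub_eq t u a hu, Multiset.map_cons,
      Multiset.sum_cons, Multiset.card_cons]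
    push_cast
    rw [neg_add, add_mul, Complex.exp_add]
    ring

theorem aeval_eq_prod_roots {f : ℝ[X]} (hf : f.Splits) (z : ℂ) :
    aeval z f = f.leadingCoeff * (f.roots.map fun r : ℝ => z - r).prod := by
  have h := (hf.map (algebraMap ℝ ℂ)).eval_eq_prod_roots z
  rw [eval_map_algebraMap, hf.roots_map] at h
  rw [h]
  simp [Multiset.map_map]

/-- The difference of arctangent sums whose cosine governs `Im (f / g)`. -/
def phase (g f : ℝ[X]) (t u : ℝ) : ℝ :=
  (f.roots.map fun r => Real.arctan ((t - r) * u)).sum -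
    (g.roots.map fun r => Real.arctan ((t - r) * u)).sum

/-- Since the degrees differ by one, exactly one factor `I` survives in the quotient, and it turns
the imaginary part into a cosine. -/
theorem im_div_pos_iff {g f : ℝ[X]} (hg : g.Splits) (hf : f.Splits) (hg0 : 0 < g.leadingCoeff)
    (hf0 : 0 < f.leadingCoeff) (hd : f.natDegree = g.natDegree + 1) (t u : ℝ) (hu : 0 < u) :
    0 < (aeval ((t : ℂ) + Complex.I / u) f / aeval ((t : ℂ) + Complex.I / u) g).im ↔
      0 < Real.cos (phase g f t u) := by
  obtain ⟨R, hR, h⟩ := exists_prod_upper_sub f.roots t u hu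
  obtain ⟨S, hS, h'⟩ := exists_prod_upper_sub g.roots t u hu
  rw [aeval_eq_prod_roots hf, aeval_eq_prod_roots hg, h, h', ← hf.natDegree_eq_card_roots,
    ← hg.natDegree_eq_card_roots, hd]
  set A := (f.roots.map fun r => Real.arctan ((t - r) * u)).sum
  set B := (g.roots.map fun r => Real.arctan ((t - r) * u)).sum
  have hA : phase g f t u = A - B := rfl
  have key : (f.leadingCoeff : ℂ) * (R * Complex.I ^ (g.natDegree + 1) *
      Complex.exp (-(A : ℝ) * Complex.I)) / (g.leadingCoeff * (S * Complex.I ^ g.natDegree *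
      Complex.exp (-(B : ℝ) * Complex.I))) =
      ((f.leadingCoeff * R / (g.leadingCoeff * S) : ℝ) : ℂ) *
        (Complex.I * Complex.exp (((-(A - B) : ℝ) : ℂ) * Complex.I)) := by
    have e : Complex.exp (((-(A - B) : ℝ) : ℂ) * Complex.I) =
        Complex.exp (-(A : ℝ) * Complex.I) / Complex.exp (-(B : ℝ) * Complex.I) := by
      rw [← Complex.exp_sub]; congr 1; push_cast; ring
    have h1 : (g.leadingCoeff : ℂ) ≠ 0 := by exact_mod_cast hg0.ne'
    have h2 : (S : ℂ) ≠ 0 := by exact_mod_cast hS.ne'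
    have h3 := Complex.exp_ne_zero (-(B : ℝ) * Complex.I)
    rw [e]
    push_cast
    field_simp
    ring
  rw [key, hA, Complex.im_ofReal_mul, Complex.I_mul_im, Complex.exp_ofReal_mul_I_re, Real.cos_neg]
  exact mul_pos_iff_of_pos_left (by positivity)

theorem upper_point (z : ℂ) :
    z = (z.re : ℂ) + Complex.I / ((1 / z.im : ℝ) : ℂ) := by
  apply Complex.ext <;> simp

theorem UpperRatio.of_interlaces {g f : ℝ[X]} (h : Interlaces g f) (hg0 : 0 < g.leadingCoeff)
    (hf0 : 0 < f.leadingCoeff) : UpperRatio g f := by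
  obtain ⟨-, hg, hf, d, α, β, hfd, hgd, hα, hβ, hfr, hgr, hi⟩ := h
  intro z hz
  rw [upper_point z, im_div_pos_iff hg hf hg0 hf0 (by omega) _ _ (by positivity)]
  set t := z.re
  set u := 1 / z.im
  have hu : 0 < u := by positivity
  have hp : phase g f t u = ∑ i, Real.arctan ((t - α i) * u) - ∑ i, Real.arctan ((t - β i) * u) := by
    simp only [phase, hfr, hgr, Multiset.map_map, Function.comp_def, Finset.sum_map_val]
  have mono : ∀ a b : ℝ, a ≤ b → Real.arctan ((t - b) * u) ≤ Real.arctan ((t - a) * u) := by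
    intro a b hab
    exact Real.arctan_strictMono.monotone (by nlinarith)
  rw [hp]
  apply Real.cos_pos_of_mem_Ioo
  constructor
  -- Pairing `α i` with `β i` leaves only the last `α`; pairing `α (i + 1)` with `β i` in the other
  -- bound leaves only the first. The phase is thus trapped between two single arctangents.
  · rw [Fin.sum_univ_castSucc]
    have := Finset.sum_le_sum fun i (_ : i ∈ Finset.univ) => mono _ _ (hi i).1
    have := Real.neg_pi_div_two_lt_arctan ((t - α (Fin.last d)) * u)
    linarith
  · rw [Fin.sum_univ_succ]
    have := Finset.sum_le_sum fun i (_ : i ∈ Finset.univ) => mono _ _ (hi i).2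
    have := Real.arctan_lt_pi_div_two ((t - α 0) * u)
    linarith

theorem exists_monotone_enumeration (s : Multiset ℝ) {n : ℕ} (hn : s.card = n) :
    ∃ α : Fin n → ℝ, Monotone α ∧ s = Finset.univ.val.map α := by
  subst hn
  induction s using Quotient.inductionOn with | _ l =>
  refine ⟨l.get ∘ Tuple.sort l.get, Tuple.monotone_sort _, ?_⟩
  have h : (Finset.univ : Finset (Fin l.length)).val.map (Tuple.sort l.get)
      = (Finset.univ : Finset (Fin l.length)).val := by
    have := congrArg Finset.val (Finset.map_univ_equiv (Tuple.sort l.get))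
    rwa [Finset.map_val] at this
  exact ((Multiset.map_map l.get (Tuple.sort l.get) _).symm.trans
    ((congrArg (Multiset.map l.get) h).trans
      ((Fin.univ_val_map _).trans (congrArg _ (List.ofFn_get l))))).symm

theorem tendsto_arctan_mul (y : ℝ) :
    Filter.Tendsto (fun u => Real.arctan (y * u)) Filter.atTop (nhds (Real.pi / 2 * Real.sign y)) := by
  rcases lt_trichotomy y 0 with h | rfl | h
  · rw [Real.sign_of_neg h, mul_neg_one]
    exact (Real.tendsto_arctan_atBot.mono_right nhdsWithin_le_nhds).comp
      (Filter.tendsto_id.const_mul_atTop_of_neg h)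
  · simp
  · rw [Real.sign_of_pos h, mul_one]
    exact (Real.tendsto_arctan_atTop.mono_right nhdsWithin_le_nhds).comp
      (Filter.tendsto_id.const_mul_atTop h)

theorem continuous_phase (g f : ℝ[X]) (t : ℝ) : Continuous (phase g f t) := by
  unfold phase
  refine Continuous.sub ?_ ?_ <;>
  · refine continuous_multiset_sum _ fun r _ => ?_
    fun_prop

theorem tendsto_phase (g f : ℝ[X]) (t : ℝ) :
    Filter.Tendsto (phase g f t) Filter.atTop
      (nhds (Real.pi / 2 * ((f.roots.map fun r => Real.sign (t - r)).sum -
        (g.roots.map fun r => Real.sign (t - r)).sum))) := by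
  rw [mul_sub, ← Multiset.sum_map_mul_left, ← Multiset.sum_map_mul_left]
  refine Filter.Tendsto.sub ?_ ?_ <;>
  · exact tendsto_multiset_sum _ fun r _ => tendsto_arctan_mul _

/-- The phase is continuous in `u`, starts at `0`, and its cosine stays positive, so it can never
reach `±π / 2`. As `u → ∞` it tends to `π / 2` times the difference of sign sums. -/
theorem UpperRatio.abs_sign_sum_le {g f : ℝ[X]} (h : UpperRatio g f) (hg : g.Splits)
    (hf : f.Splits) (hg0 : 0 < g.leadingCoeff) (hf0 : 0 < f.leadingCoeff)
    (hd : f.natDegree = g.natDegree + 1) (t : ℝ) :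
    |(f.roots.map fun r => Real.sign (t - r)).sum -
      (g.roots.map fun r => Real.sign (t - r)).sum| ≤ 1 := by
  have h0 : phase g f t 0 = 0 := by simp [phase]
  have hcos : ∀ u : ℝ, 0 ≤ u → 0 < Real.cos (phase g f t u) := by
    intro u hu
    rcases hu.eq_or_lt with rfl | hu
    · simp [h0]
    · rw [← im_div_pos_iff hg hf hg0 hf0 hd t u hu]
      apply h
      simp [hu]
  have hb : ∀ u : ℝ, 0 ≤ u → |phase g f t u| ≤ Real.pi / 2 := by
    intro u hu
    by_contra! hlt
    have hc : ContinuousOn (fun u => |phase g f t u|) (Set.Icc 0 u) :=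
      (continuous_phase g f t).abs.continuousOn
    obtain ⟨v, hv, hv'⟩ := intermediate_value_Icc hu hc (show Real.pi / 2 ∈ _ from
      ⟨by simp [h0]; positivity, hlt.le⟩)
    have := hcos v hv.1
    rw [← Real.cos_abs] at this
    simp only at hv'
    rw [hv', Real.cos_pi_div_two] at this
    exact this.false
  have hlim := (tendsto_phase g f t).abs
  have := le_of_tendsto hlim (Filter.eventually_atTop.2 ⟨0, fun u hu => hb u hu⟩)
  rw [abs_mul, abs_of_pos (by positivity : 0 < Real.pi / 2)] at this
  exact le_of_mul_le_mul_left (by linarith) (by positivity : 0 < Real.pi / 2)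

theorem sum_threshold {n k : ℕ} (hk : k ≤ n) :
    ∑ j : Fin n, (if j.val < k then (1 : ℝ) else -1) = 2 * k - n := by
  obtain ⟨m, rfl⟩ := Nat.exists_eq_add_of_le hk
  rw [Fin.sum_univ_add]
  simp
  ring

theorem neg_one_le_sign (y : ℝ) : -1 ≤ Real.sign y := by
  rcases Real.sign_apply_eq y with h | h | h <;> rw [h] <;> norm_num

theorem sign_le_one (y : ℝ) : Real.sign y ≤ 1 := by
  rcases Real.sign_apply_eq y with h | h | h <;> rw [h] <;> norm_num

/-- A sign sum at `t` compares the numbers of zeros on the two sides of `t`. A violated inequality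
leaves room for a `t` at which the two sums differ by at least `3`. -/
theorem Interlaces.of_upperRatio {g f : ℝ[X]} (h : UpperRatio g f) (hg : g.Splits)
    (hf : f.Splits) (hg0 : 0 < g.leadingCoeff) (hf0 : 0 < f.leadingCoeff)
    (hd : f.natDegree = g.natDegree + 1) : Interlaces g f := by
  obtain ⟨α, hα, hfr⟩ := exists_monotone_enumeration f.roots
    (n := g.natDegree + 1) (by rw [← hf.natDegree_eq_card_roots, hd])
  obtain ⟨β, hβ, hgr⟩ := exists_monotone_enumeration g.roots
    (n := g.natDegree) (by rw [← hg.natDegree_eq_card_roots])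
  refine ⟨leadingCoeff_ne_zero.1 hg0.ne', hg, hf, g.natDegree, α, β, hd, rfl, hα, hβ, hfr, hgr, ?_⟩
  have hs := h.abs_sign_sum_le hg hf hg0 hf0 hd
  simp only [hfr, hgr, Multiset.map_map, Function.comp_def, Finset.sum_map_val] at hs
  have lower : ∀ {n : ℕ} (γ : Fin n → ℝ) (t : ℝ) (k : ℕ), k ≤ n → (∀ j : Fin n, j.val < k → γ j < t) →
      (2 * k - n : ℝ) ≤ ∑ j, Real.sign (t - γ j) := by
    intro n γ t k hk hj
    rw [← sum_threshold hk]
    refine Finset.sum_le_sum fun j _ => ?_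
    split_ifs with h
    · rw [Real.sign_of_pos (sub_pos.2 (hj j h))]
    · exact neg_one_le_sign _
  have upper : ∀ {n : ℕ} (γ : Fin n → ℝ) (t : ℝ) (k : ℕ), k ≤ n → (∀ j : Fin n, k ≤ j.val → t < γ j) →
      ∑ j, Real.sign (t - γ j) ≤ (2 * k - n : ℝ) := by
    intro n γ t k hk hj
    rw [← sum_threshold hk]
    refine Finset.sum_le_sum fun j _ => ?_
    split_ifs with h
    · exact sign_le_one _
    · rw [Real.sign_of_neg (sub_neg.2 (hj j (not_lt.1 h)))]
  intro i
  constructor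
  · by_contra! hlt
    obtain ⟨t, ht1, ht2⟩ := exists_between hlt
    have h1 := upper α t i (by omega) fun j hj => ht2.trans_le (hα (by
      rw [Fin.le_def]; simpa using hj))
    have h2 := lower β t (i + 1) (by omega) fun j hj => (hβ (by rw [Fin.le_def]; omega)).trans_lt ht1
    have h3 := (abs_le.1 (hs t)).1
    push_cast at h1 h2
    linarith
  · by_contra! hlt
    obtain ⟨t, ht1, ht2⟩ := exists_between hlt
    have h1 := lower α t (i + 2) (by omega) fun j hj => (hα (by
      rw [Fin.le_def, Fin.val_succ]; omega)).trans_lt ht1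
    have h2 := upper β t i (by omega) fun j hj => ht2.trans_le (hβ (by rw [Fin.le_def]; omega))
    have h3 := (abs_le.1 (hs t)).2
    push_cast at h1 h2
    linarith

/-! ### Real-rootedness as absence of zeros in the upper half plane -/

theorem splits_of_upper_ne_zero {f : ℝ[X]} (h : ∀ z : ℂ, 0 < z.im → aeval z f ≠ 0) :
    f.Splits := by
  refine Splits.of_splits_map (algebraMap ℝ ℂ) (IsAlgClosed.splits _) fun z hz => ?_
  have hz0 : aeval z f = 0 := by
    have := (mem_roots'.1 hz).2
    rwa [IsRoot.def, eval_map_algebraMap] at this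
  rcases lt_trichotomy z.im 0 with hi | hi | hi
  · refine absurd ?_ (h (starRingEnd ℂ z) (by simpa using hi))
    rw [aeval_conj, hz0, map_zero]
  · exact ⟨z.re, Complex.ext rfl (by simp [hi])⟩
  · exact absurd hz0 (h z hi)

theorem aeval_ne_zero_of_splits {f : ℝ[X]} (hf : f.Splits) (h0 : f ≠ 0) {z : ℂ} (hz : 0 < z.im) :
    aeval z f ≠ 0 := by
  rw [aeval_eq_prod_roots hf]
  refine mul_ne_zero (by exact_mod_cast leadingCoeff_ne_zero.2 h0) ?_
  rw [Ne, Multiset.prod_eq_zero_iff, Multiset.mem_map]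
  rintro ⟨r, -, hr⟩
  have := congrArg Complex.im hr
  simp at this
  exact hz.ne' this

theorem UpperRatio.ne_zero_left {g f : ℝ[X]} (h : UpperRatio g f) {z : ℂ} (hz : 0 < z.im) :
    aeval z g ≠ 0 := by
  intro h0
  simpa [h0] using h z hz

theorem UpperRatio.ne_zero_right {g f : ℝ[X]} (h : UpperRatio g f) {z : ℂ} (hz : 0 < z.im) :
    aeval z f ≠ 0 := by
  intro h0
  simpa [h0] using h z hz

/-! ### The diamond product -/

section Diamond

variable {R : Type*} [CommRing R]

/-- The diamond product `∑ n, (f⁽ⁿ⁾ / n!) (g⁽ⁿ⁾ / n!) (X (X + 1))ⁿ`, as a linear map in `f`. -/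
def diamond (g : R[X]) : R[X] →ₗ[R] R[X] :=
  ∑ n ∈ Finset.range (g.natDegree + 1),
    LinearMap.mulRight R (hasseDeriv n g * (X * (X + 1)) ^ n) ∘ₗ hasseDeriv n

theorem diamond_apply (g f : R[X]) :
    diamond g f = ∑ n ∈ Finset.range (g.natDegree + 1),
      hasseDeriv n f * (hasseDeriv n g * (X * (X + 1)) ^ n) := by
  simp [diamond, mul_assoc]

theorem diamond_C (g : R[X]) (a : R) : diamond g (C a) = C a * g := by
  rw [diamond_apply, Finset.sum_range_succ', Finset.sum_eq_zero]
  · simp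
  · intro n _
    rw [hasseDeriv_C _ _ (Nat.succ_pos n), zero_mul]

theorem hasseDeriv_map_eq {S : Type*} [CommRing S] (φ : R →+* S) (n : ℕ) (f : R[X]) :
    hasseDeriv n (f.map φ) = (hasseDeriv n f).map φ := by
  ext k
  simp [hasseDeriv_coeff]

theorem map_diamond {S : Type*} [CommRing S] (φ : R →+* S) (hφ : Function.Injective φ)
    (g f : R[X]) : (diamond g f).map φ = diamond (g.map φ) (f.map φ) := by
  simp only [diamond_apply, Polynomial.map_sum, hasseDeriv_map_eq, natDegree_map_eq_of_injective hφ]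
  simp

theorem derivative_hasseDeriv (n : ℕ) (f : R[X]) :
    derivative (hasseDeriv n f) = (n + 1 : R[X]) * hasseDeriv (n + 1) f := by
  have h := LinearMap.congr_fun (hasseDeriv_comp (R := R) 1 n) f
  rw [hasseDeriv_one, LinearMap.comp_apply] at h
  rw [h]
  simp [add_comm 1 n]
  ring

/-- The operator that corresponds to multiplication by `m` under `X ^ k ↦ m.choose k`. -/
def raise (f : R[X]) : R[X] := X * f + X * (X + 1) * derivative f

end Diamond

/-- This is the Leibniz rule, in which `X * (X + 1)` contributes only its Hasse derivatives of order
at most two. -/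
theorem hasseDeriv_raise_succ (f : ℝ[X]) (n : ℕ) :
    hasseDeriv (n + 1) (raise f) = X * hasseDeriv (n + 1) f + ((n : ℝ[X]) + 1) * hasseDeriv n f +
      X * (X + 1) * (((n : ℝ[X]) + 2) * hasseDeriv (n + 2) f) +
      (2 * X + 1) * (((n : ℝ[X]) + 1) * hasseDeriv (n + 1) f) := by
  induction n with
  | zero =>
    have h := derivative_hasseDeriv 1 f
    rw [hasseDeriv_one] at h
    norm_num at h
    simp only [zero_add, hasseDeriv_one, hasseDeriv_zero', raise, Nat.cast_zero, derivative_add,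
      derivative_mul, derivative_X, derivative_one, h]
    ring
  | succ n ih =>
    have h := derivative_hasseDeriv (n + 1) (raise f)
    have h0 := derivative_hasseDeriv n f
    have h1 := derivative_hasseDeriv (n + 1) f
    have h2 := derivative_hasseDeriv (n + 2) f
    -- Differentiating a Hasse derivative of order `n + 1` produces the factor `n + 2`, which has to
    -- be cancelled.
    have hn : ((n + 1 : ℕ) + 1 : ℝ[X]) ≠ 0 := by exact_mod_cast Nat.succ_ne_zero (n + 1)
    refine mul_left_cancel₀ hn ?_
    rw [← h, ih]
    have e1 : derivative (n : ℝ[X]) = 0 := derivative_natCast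
    have e2 : derivative (2 : ℝ[X]) = 0 := derivative_ofNat 2
    simp only [derivative_add, derivative_mul, derivative_X, derivative_one, e1, e2, h0, h1, h2]
    push_cast
    ring

theorem diamond_raise (g f : ℝ[X]) : diamond g (raise f) = raise (diamond g f) := by
  have hg : hasseDeriv (g.natDegree + 1) g = 0 :=
    hasseDeriv_eq_zero_of_lt_natDegree _ _ (Nat.lt_succ_self _)
  have h0 : raise f = X * f + X * (X + 1) * hasseDeriv 1 f := by rw [hasseDeriv_one]; rfl
  set K := g.natDegree
  -- The identity telescopes: truncating the sums at `K` leaves a single boundary term, which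
  -- contains `hasseDeriv (K + 1) g` and vanishes at `K = g.natDegree`.
  have key : ∀ K : ℕ, (∑ n ∈ Finset.range (K + 1), hasseDeriv n (raise f) *
      (hasseDeriv n g * (X * (X + 1)) ^ n)) + ((K : ℝ[X]) + 1) * hasseDeriv K f *
        (hasseDeriv (K + 1) g * (X * (X + 1)) ^ (K + 1)) =
      X * (∑ n ∈ Finset.range (K + 1), hasseDeriv n f * (hasseDeriv n g * (X * (X + 1)) ^ n)) +
      X * (X + 1) * derivative (∑ n ∈ Finset.range (K + 1), hasseDeriv n f *
        (hasseDeriv n g * (X * (X + 1)) ^ n)) := by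
    intro K
    induction K with
    | zero =>
      simp only [zero_add, Finset.sum_range_one, hasseDeriv_zero', pow_zero, mul_one, h0,
        derivative_mul, hasseDeriv_one, Nat.cast_zero, pow_one]
      ring
    | succ K ih =>
      rw [Finset.sum_range_succ _ (K + 1), Finset.sum_range_succ _ (K + 1), derivative_add,
        hasseDeriv_raise_succ]
      simp only [derivative_mul, derivative_pow_succ, derivative_add, derivative_X, derivative_one,
        derivative_hasseDeriv]
      push_cast
      simp only [map_add, map_natCast, map_one]
      linear_combination ih
  have := key K
  rw [hg, zero_mul, mul_zero, add_zero] at this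
  rw [diamond_apply, raise, diamond_apply]
  exact this

/-- The linear functional `X ^ k ↦ m.choose k`. -/
def chooseEval (m : ℕ) : ℝ[X] →ₗ[ℝ] ℝ :=
  Polynomial.lsum fun k => (m.choose k : ℝ) • LinearMap.id

theorem chooseEval_apply (m : ℕ) (f : ℝ[X]) :
    chooseEval m f = f.sum fun k a => (m.choose k : ℝ) * a := by
  simp [chooseEval, lsum_apply]

theorem chooseEval_monomial (m k : ℕ) (a : ℝ) :
    chooseEval m (monomial k a) = m.choose k * a := by
  rw [chooseEval_apply, sum_monomial_index _ _ (by simp)]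

theorem raise_monomial (k : ℕ) (a : ℝ) :
    raise (monomial k a) = ((k : ℝ) + 1) • monomial (k + 1) a + (k : ℝ) • monomial k a := by
  have e : ∀ (n : ℕ) (b : ℝ), monomial n b = C b * X ^ n := fun n b =>
    C_mul_X_pow_eq_monomial.symm
  rcases k with - | k
  · simp only [raise, e]
    simp
  · rw [raise, derivative_monomial, e, e, e, smul_eq_C_mul, smul_eq_C_mul, Nat.add_sub_cancel]
    push_cast
    simp only [map_add, map_mul, map_natCast, map_one]
    ring

theorem chooseEval_raise (m : ℕ) (f : ℝ[X]) : chooseEval m (raise f) = m * chooseEval m f := by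
  induction f using Polynomial.induction_on' with
  | add p q hp hq =>
    have : raise (p + q) = raise p + raise q := by simp [raise]; ring
    rw [this, map_add, map_add, hp, hq, mul_add]
  | monomial k a =>
    rw [raise_monomial, map_add, map_smul, map_smul]
    simp only [chooseEval_monomial, smul_eq_mul]
    have h : (m.choose (k + 1) : ℝ) * (k + 1) + m.choose k * k = m.choose k * m := by
      rcases le_or_gt k m with h | h
      · have := Nat.choose_succ_right_eq m k
        rw [← Nat.cast_inj (R := ℝ)] at this
        push_cast [Nat.cast_sub h] at this
        linear_combination this
      · rw [Nat.choose_eq_zero_of_lt h, Nat.choose_eq_zero_of_lt (by omega)]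
        simp
    linear_combination a * h

/-- As functionals of `f`, both sides turn `raise` into multiplication by `m`. Constants together
with `raise` reach every monomial, because `raise` sends `X ^ k` to `(k + 1) X ^ (k + 1) + k X ^ k`.
-/
theorem chooseEval_diamond (m : ℕ) (g f : ℝ[X]) :
    chooseEval m (diamond g f) = chooseEval m f * chooseEval m g := by
  induction f using Polynomial.induction_on' with
  | add p q hp hq => simp only [map_add, hp, hq, add_mul]
  | monomial k a =>
    induction k with
    | zero =>
      rw [monomial_zero_left, diamond_C, ← smul_eq_C_mul,
        map_smul, ← monomial_zero_left, chooseEval_monomial]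
      simp
    | succ k ih =>
      have h1 := congrArg (chooseEval m) (raise_monomial k a)
      have h2 := congrArg (fun p => chooseEval m (diamond g p)) (raise_monomial k a)
      simp only [diamond_raise, chooseEval_raise, map_add, map_smul, smul_eq_mul, ih] at h1 h2
      have hk : ((k : ℝ) + 1) ≠ 0 := by positivity
      refine mul_left_cancel₀ hk ?_
      linear_combination chooseEval m g * h1 - h2

/-- Taking `m` to be the trailing degree of `f - g` kills every coefficient except the lowest. -/
theorem eq_of_chooseEval_eq {f g : ℝ[X]} (h : ∀ m, chooseEval m f = chooseEval m g) : f = g := by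
  rw [← sub_eq_zero]
  by_contra hne
  set p := f - g
  have h0 : chooseEval p.natTrailingDegree p = 0 := by rw [map_sub, h, sub_self]
  rw [chooseEval_apply, Polynomial.sum, Finset.sum_eq_single p.natTrailingDegree] at h0
  · rw [Nat.choose_self, Nat.cast_one, one_mul, coeff_natTrailingDegree_eq_zero] at h0
    exact hne h0
  · intro k hk hk'
    have := natTrailingDegree_le_of_mem_supp k hk
    rw [Nat.choose_eq_zero_of_lt (by omega), Nat.cast_zero, zero_mul]
  · intro hn
    rw [notMem_support_iff.1 hn, mul_zero]

/-! ### The diamond product preserves the absence of zeros in the upper half plane -/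

/-- By Gauss–Lucas the zeros of all nonconstant derivatives stay in the open lower half plane, so no
derivative up to the degree vanishes at `0`. -/
theorem coeff_ne_zero_of_lower_roots (k : ℕ) {p : ℂ[X]} (h0 : p ≠ 0)
    (h : ∀ z, p.eval z = 0 → z.im < 0) (hk : k ≤ p.natDegree) : p.coeff k ≠ 0 := by
  induction k generalizing p with
  | zero =>
    intro hc
    rw [coeff_zero_eq_eval_zero] at hc
    simpa using h 0 hc
  | succ k ih =>
    have hd := natDegree_derivative p
    have hpos : 0 < p.degree := natDegree_pos_iff_degree_pos.1 (by omega)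
    have hp' : derivative p ≠ 0 := fun hz => by
      have := derivative_eq_zero.1 hz
      omega
    have hr : ∀ z, (derivative p).eval z = 0 → z.im < 0 := by
      intro z hz
      have hmem : z ∈ (derivative p).rootSet ℂ := by
        rw [mem_rootSet]; exact ⟨hp', by simpa using hz⟩
      have hc := rootSet_derivative_subset_convexHull_rootSet hpos hmem
      refine convexHull_min ?_ (convex_halfSpace_im_lt 0) hc
      intro w hw
      exact h w (by simpa using (mem_rootSet.1 hw).2)
    have := ih hp' hr (by omega)
    rw [coeff_derivative] at this
    exact left_ne_zero_of_mul this

/-- The interval `[-1, 0]` matters because `r * (r + 1) ≤ 0` there: the sign of `s.im` is that of `r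
* (r + 1) - |x - r| ^ 2`. -/
theorem im_neg_of_mul_sub_eq {s x : ℂ} {r : ℝ} (hx : 0 < x.im) (h1 : -1 ≤ r) (h2 : r ≤ 0)
    (h : s * (r - x) = x * (x + 1)) : s.im < 0 := by
  have hre := congrArg Complex.re h
  have him := congrArg Complex.im h
  simp at hre him
  have key : s.im * ((r - x.re) ^ 2 + x.im ^ 2) =
      x.im * (-(x.re - r) ^ 2 - x.im ^ 2 + r * (r + 1)) := by
    linear_combination x.im * hre + (r - x.re) * him
  by_contra! hs
  have h3 : 0 ≤ s.im * ((r - x.re) ^ 2 + x.im ^ 2) := by positivity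
  have h4 : x.im * (-(x.re - r) ^ 2 - x.im ^ 2 + r * (r + 1)) < 0 := by
    apply mul_neg_of_pos_of_neg hx
    nlinarith [sq_nonneg (x.re - r), mul_pos hx hx]
  linarith

/-- With `t = x * (x + 1)`, the value is `∑ aₙ bₙ tⁿ` for the Taylor coefficients `aₙ`, `bₙ` of `f`,
`g` at `x`. Reversing the second sequence makes this one coefficient of a product whose zeros all
lie in the lower half plane. -/
theorem eval_diamond_ne_zero {g f : ℂ[X]} (hg0 : g ≠ 0)
    (hg : ∀ z, g.eval z = 0 → ∃ r : ℝ, z = r ∧ -1 ≤ r ∧ r ≤ 0)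
    (hf : ∀ z : ℂ, 0 < z.im → f.eval z ≠ 0) {x : ℂ} (hx : 0 < x.im) :
    (diamond g f).eval x ≠ 0 := by
  set t := x * (x + 1) with ht
  have ht0 : t ≠ 0 := by
    refine mul_ne_zero ?_ ?_ <;> intro h0 <;> have := congrArg Complex.im h0 <;> simp at this <;>
      exact hx.ne' this
  set m := g.natDegree with hm
  set G := (taylor x g).comp (C t * X) with hG
  have hGc : ∀ n, G.coeff n = (hasseDeriv n g).eval x * t ^ n := fun n => by
    rw [hG, comp_C_mul_X_coeff, taylor_coeff]
  have hGd : G.natDegree ≤ m := by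
    rw [hG, natDegree_comp, natDegree_taylor, natDegree_C_mul_X _ ht0, mul_one]
  set Q := reflect m G with hQ
  have hQ0 : Q.eval 0 ≠ 0 := by
    rw [← coeff_zero_eq_eval_zero, hQ, coeff_reflect, revAt_zero, hGc, hm,
      hasseDeriv_natDegree_eq_C, eval_C]
    exact mul_ne_zero (leadingCoeff_ne_zero.2 hg0) (pow_ne_zero _ ht0)
  -- A zero `s` of the reversed polynomial satisfies `x + t / s = r` for some zero `r` of `g`.
  have hQr : ∀ s, Q.eval s = 0 → s.im < 0 := by
    intro s hs
    have hs0 : s ≠ 0 := fun h => hQ0 (h ▸ hs)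
    let := invertibleOfNonzero (inv_ne_zero hs0)
    have h := eval₂_reflect_mul_pow (RingHom.id ℂ) s⁻¹ m G hGd
    have hi : (⅟ s⁻¹ : ℂ) = s := by rw [invOf_eq_inv, inv_inv]
    rw [hi, ← hQ] at h
    change Q.eval s * _ = G.eval s⁻¹ at h
    rw [hs, zero_mul, hG, eval_comp, taylor_eval] at h
    obtain ⟨r, hr, h1, h2⟩ := hg _ h.symm
    simp at hr
    refine im_neg_of_mul_sub_eq hx h1 h2 ?_
    rw [← hr]
    field_simp
    ring
  have hT0 : taylor x f ≠ 0 := by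
    rw [Ne, taylor_eq_zero]
    rintro rfl
    exact hf x hx (by simp)
  have hQne : Q ≠ 0 := by rintro h; simp [h] at hQ0
  have hprod : ∀ z, (taylor x f * Q).eval z = 0 → z.im < 0 := by
    intro z hz
    rw [eval_mul, mul_eq_zero] at hz
    rcases hz with hz | hz
    · by_contra! h
      rw [taylor_eval] at hz
      exact hf _ (by simp; linarith) hz
    · exact hQr z hz
  have hdeg : m ≤ (taylor x f * Q).natDegree := by
    rw [natDegree_mul hT0 hQne]
    have : m ≤ Q.natDegree := by
      refine le_natDegree_of_ne_zero ?_
      rw [hQ, coeff_reflect, revAt_le le_rfl, Nat.sub_self, hGc, hasseDeriv_zero', pow_zero, mul_one]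
      intro h
      obtain ⟨r, rfl, -⟩ := hg x h
      simp at hx
    omega
  have hc := coeff_ne_zero_of_lower_roots m (mul_ne_zero hT0 hQne) hprod hdeg
  convert hc using 1
  rw [coeff_mul, Finset.Nat.sum_antidiagonal_eq_sum_range_succ_mk, diamond_apply, eval_finsetSum]
  refine Finset.sum_congr rfl fun n hn => ?_
  have hn' : n ≤ m := Nat.lt_succ_iff.1 (Finset.mem_range.1 hn)
  rw [taylor_coeff, hQ, coeff_reflect, revAt_le (Nat.sub_le _ _), Nat.sub_sub_self hn', hGc]
  simp [ht]

/-! ### Packed partitions with natural number values -/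

section Height

variable {P : Type*}

/-- The number of values of a map. -/
def height (σ : P → ℕ) : ℕ := (Set.range σ).ncard

theorem ncard_Iio (k : ℕ) : (Set.Iio k).ncard = k := by
  rw [← Finset.coe_Iio, Set.ncard_coe_finset, Nat.card_Iio]

theorem height_eq_of_range {σ : P → ℕ} {k : ℕ} (h : Set.range σ = Set.Iio k) : height σ = k := by
  rw [height, h, ncard_Iio]

theorem isLowerSet_of_range {σ : P → ℕ} {k : ℕ} (h : Set.range σ = Set.Iio k) :
    IsLowerSet (Set.range σ) := h ▸ isLowerSet_Iio k

theorem range_eq_Iio [Finite P] {σ : P → ℕ} (h : IsLowerSet (Set.range σ)) :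
    Set.range σ = Set.Iio (height σ) := by
  classical
  have hex : ∃ n, n ∉ Set.range σ := (Set.finite_range σ).exists_notMem
  have : Set.range σ = Set.Iio (Nat.find hex) := by
    ext v
    constructor
    · intro hv
      by_contra! hle
      exact Nat.find_spec hex (h (not_lt.1 hle) hv)
    · intro hv
      exact not_not.1 (Nat.find_min hex hv)
  rwa [height_eq_of_range this]

theorem lt_height [Finite P] {σ : P → ℕ} (h : IsLowerSet (Set.range σ)) (x : P) :
    σ x < height σ := by
  have := Set.mem_range_self (f := σ) x
  rwa [range_eq_Iio h] at this

theorem height_le_card [Finite P] (σ : P → ℕ) : height σ ≤ Nat.card P := by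
  rw [height, ← Set.image_univ, ← Set.ncard_univ]
  exact Set.ncard_image_le

theorem height_pos [Finite P] [Nonempty P] (σ : P → ℕ) : 0 < height σ := by
  rw [height, Set.ncard_pos]
  exact Set.range_nonempty σ

end Height

section Packed

variable {P : Type*} [PartialOrder P]

/-- A `(P, ω)`-partition with values in `ℕ`. -/
def IsNatPartition (ω : P → ℕ) (σ : P → ℕ) : Prop :=
  (∀ x y : P, x ≤ y → σ y ≤ σ x) ∧ (∀ x y : P, x < y → ω y < ω x → σ y < σ x)

theorem isNatPartition_congr {ω σ τ : P → ℕ} (h : ∀ x y, σ x < σ y ↔ τ x < τ y) :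
    IsNatPartition ω σ ↔ IsNatPartition ω τ := by
  simp only [IsNatPartition, ← not_lt, h]

theorem isNatPartition_add_iff {ω σ : P → ℕ} (c : ℕ) :
    IsNatPartition ω (fun x => σ x + c) ↔ IsNatPartition ω σ :=
  isNatPartition_congr fun x y => by omega

theorem packings_finite [Finite P] (ω : P → ℕ) :
    {σ : P → ℕ | IsNatPartition ω σ ∧ IsLowerSet (Set.range σ)}.Finite := by
  refine (Set.Finite.pi' fun _ : P => Set.finite_Iio (Nat.card P)).subset ?_
  intro σ hσ x
  exact (lt_height hσ.2 x).trans_le (height_le_card σ)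

/-- The `(P, ω)`-partitions whose values form an initial segment of `ℕ`. -/
def packings [Finite P] (ω : P → ℕ) : Finset (P → ℕ) := (packings_finite ω).toFinset

theorem mem_packings [Finite P] {ω σ : P → ℕ} :
    σ ∈ packings ω ↔ IsNatPartition ω σ ∧ IsLowerSet (Set.range σ) := by
  simp [packings]

theorem surjCount_eq [Finite P] (ω : P → ℕ) (k : ℕ) :
    surjCount ω k = ((packings ω).filter fun σ => height σ = k).card := by
  have hinj : Function.Injective fun (σ : P → Fin k) (x : P) => (σ x).val := by
    intro σ τ h
    funext x
    exact Fin.ext (congrFun h x)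
  have h1 : surjCount ω k = Set.ncard {σ : P → Fin k | IsPartition ω σ ∧ Function.Surjective σ} :=
    rfl
  rw [h1, ← Set.ncard_image_of_injective _ hinj, ← Set.ncard_coe_finset]
  congr 1
  ext ρ
  simp only [Set.mem_image, Set.mem_ofPred_eq, Finset.coe_filter, mem_packings]
  constructor
  · rintro ⟨σ, ⟨hp, hs⟩, rfl⟩
    have hr : (Set.range fun x => (σ x).val) = Set.Iio k := by
      ext v
      constructor
      · rintro ⟨x, rfl⟩
        exact (σ x).2
      · intro hv
        obtain ⟨x, hx⟩ := hs ⟨v, hv⟩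
        exact ⟨x, by simp [hx]⟩
    exact ⟨⟨hp, isLowerSet_of_range hr⟩, height_eq_of_range hr⟩
  · rintro ⟨⟨hp, hl⟩, rfl⟩
    refine ⟨fun x => ⟨ρ x, lt_height hl x⟩, ⟨hp, fun v => ?_⟩, rfl⟩
    have hv : v.val ∈ Set.range ρ := by rw [range_eq_Iio hl]; exact v.2
    obtain ⟨x, hx⟩ := hv
    exact ⟨x, Fin.ext hx⟩

theorem EPoly_coeff (ω : P → ℕ) (k : ℕ) :
    (EPoly ω).coeff k = if k < Nat.card P + 1 then (surjCount ω k : ℝ) else 0 := by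
  simp [EPoly, coeff_X_pow]

theorem EPoly_eq_sum [Finite P] (ω : P → ℕ) :
    EPoly ω = ∑ σ ∈ packings ω, X ^ height σ := by
  ext k
  rw [EPoly_coeff, finsetSum_coeff]
  simp only [coeff_X_pow]
  rw [surjCount_eq]
  simp only [eq_comm (a := k), Finset.sum_boole]
  split_ifs with hk
  · rfl
  · rw [Finset.filter_false_of_mem, Finset.card_empty, Nat.cast_zero]
    intro σ _ h
    have := height_le_card σ
    omega

theorem EPoly_coeff_nonneg (ω : P → ℕ) (k : ℕ) : 0 ≤ (EPoly ω).coeff k := by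
  rw [EPoly_coeff]
  split_ifs
  · exact Nat.cast_nonneg _
  · exact le_rfl

/-- A reversed linear extension is strictly decreasing, hence a partition for every labelling. -/
theorem surjCount_card_pos [Finite P] (ω : P → ℕ) : 0 < surjCount ω (Nat.card P) := by
  classical
  have := Fintype.ofFinite P
  have : Fintype (LinearExtension P) := ‹Fintype P›
  let e := Fintype.orderIsoFinOfCardEq (LinearExtension P)
    (show Fintype.card (LinearExtension P) = Nat.card P from Nat.card_eq_fintype_card.symm)
  let ι : P → LinearExtension P := toLinearExtension
  have hι : StrictMono ι := toLinearExtension.monotone.strictMono_of_injective fun _ _ h => h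
  refine @Nat.card_pos _ ⟨⟨fun x => (e.symm (ι x)).rev, ⟨fun x y h => ?_, fun x y h _ => ?_⟩, ?_⟩⟩ _
  · exact Fin.rev_le_rev.2 (e.symm.monotone (hι.monotone h))
  · exact Fin.rev_lt_rev.2 (e.symm.strictMono (hι h))
  · exact Fin.rev_surjective.comp (e.symm.surjective.comp fun x => ⟨x, rfl⟩)

theorem EPoly_natDegree [Finite P] (ω : P → ℕ) : (EPoly ω).natDegree = Nat.card P := by
  apply natDegree_eq_of_le_of_coeff_ne_zero
  · rw [natDegree_le_iff_coeff_eq_zero]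
    intro N hN
    rw [EPoly_coeff, if_neg (by omega)]
  · rw [EPoly_coeff, if_pos (Nat.lt_succ_self _)]
    exact_mod_cast (surjCount_card_pos ω).ne'

theorem EPoly_leadingCoeff_pos [Finite P] (ω : P → ℕ) : 0 < (EPoly ω).leadingCoeff := by
  rw [leadingCoeff, EPoly_natDegree, EPoly_coeff, if_pos (Nat.lt_succ_self _)]
  exact_mod_cast surjCount_card_pos ω

theorem EPoly_ne_zero [Finite P] (ω : P → ℕ) : EPoly ω ≠ 0 :=
  leadingCoeff_ne_zero.1 (EPoly_leadingCoeff_pos ω).ne'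

theorem EPoly_of_isEmpty [IsEmpty P] (ω : P → ℕ) : EPoly ω = 1 := by
  have h : (EPoly ω).natDegree = 0 := by rw [EPoly_natDegree]; simp
  rw [eq_C_of_natDegree_eq_zero h, EPoly_coeff, if_pos (Nat.succ_pos _), surjCount]
  have : Nat.card {σ : P → Fin 0 // IsPartition ω σ ∧ Function.Surjective σ} = 1 := by
    rw [Nat.card_eq_one_iff_exists]
    exact ⟨⟨isEmptyElim, ⟨isEmptyElim, isEmptyElim⟩, fun v => v.elim0⟩, fun σ =>
      Subtype.ext (funext isEmptyElim)⟩
  rw [this]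
  simp

/-! ### Counting all partitions into a chain -/

theorem bounded_finite [Finite P] (ω : P → ℕ) (m : ℕ) :
    {σ : P → ℕ | IsNatPartition ω σ ∧ ∀ x, σ x < m}.Finite :=
  (Set.Finite.pi' fun _ : P => Set.finite_Iio m).subset fun _ hσ x => hσ.2 x

theorem card_ofPred_mem (T : Finset ℕ) (h : (Set.ofPred fun n => n ∈ T).Finite) :
    h.toFinset.card = T.card := by
  congr 1
  ext
  simp

theorem nth_mem_finset {T : Finset ℕ} {a : ℕ} (ha : a < T.card) : Nat.nth (· ∈ T) a ∈ T :=
  Nat.nth_mem a fun hf => by rwa [card_ofPred_mem]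

theorem nth_lt_nth_iff_finset {T : Finset ℕ} {a b : ℕ} (ha : a < T.card) (hb : b < T.card) :
    Nat.nth (· ∈ T) a < Nat.nth (· ∈ T) b ↔ a < b := by
  have h : ∀ {a b : ℕ}, b < T.card → a < b → Nat.nth (· ∈ T) a < Nat.nth (· ∈ T) b :=
    fun hb hab => Nat.nth_lt_nth' hab fun hf => by rwa [card_ofPred_mem]
  refine ⟨fun hlt => ?_, h hb⟩
  by_contra! hle
  rcases hle.eq_or_lt with rfl | hlt'
  · exact hlt.false
  · exact (hlt.trans (h ha hlt')).false

theorem count_nth_finset {T : Finset ℕ} {a : ℕ} (ha : a < T.card) :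
    Nat.count (· ∈ T) (Nat.nth (· ∈ T) a) = a :=
  Nat.count_nth fun hf => by rwa [card_ofPred_mem]

theorem count_lt_card_finset {T : Finset ℕ} {a : ℕ} (ha : a ∈ T) :
    Nat.count (· ∈ T) a < T.card := by
  have hf : (Set.ofPred fun n => n ∈ T).Finite := T.finite_toSet
  rw [← card_ofPred_mem T hf]
  exact Nat.count_lt_card hf ha

theorem count_lt_count_iff_finset {T : Finset ℕ} {a b : ℕ} (ha : a ∈ T) (hb : b ∈ T) :
    Nat.count (· ∈ T) a < Nat.count (· ∈ T) b ↔ a < b := by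
  rw [← nth_lt_nth_iff_finset (count_lt_card_finset ha) (count_lt_card_finset hb),
    Nat.nth_count ha, Nat.nth_count hb]

/-- A partition with values below `m` amounts to a packed partition and the set `T` of its values.
`Nat.count` standardizes the values and `Nat.nth` restores them. -/
theorem chooseEval_EPoly [Finite P] (ω : P → ℕ) (m : ℕ) :
    chooseEval m (EPoly ω) =
      ({σ : P → ℕ | IsNatPartition ω σ ∧ ∀ x, σ x < m}.ncard : ℝ) := by
  classical
  have h1 : chooseEval m (EPoly ω) = ∑ σ ∈ packings ω, (m.choose (height σ) : ℝ) := by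
    rw [EPoly_eq_sum, map_sum]
    refine Finset.sum_congr rfl fun σ _ => ?_
    rw [← monomial_one_right_eq_X_pow, chooseEval_monomial, mul_one]
  rw [h1, ← Nat.cast_sum, Set.ncard_eq_toFinset_card _ (bounded_finite ω m)]
  congr 1
  have h2 : ∑ σ ∈ packings ω, m.choose (height σ) =
      ((packings ω).sigma fun σ => Finset.powersetCard (height σ) (Finset.range m)).card := by
    rw [Finset.card_sigma]
    simp
  rw [h2]
  symm
  refine Finset.card_bij' (fun ρ _ => ⟨fun x => Nat.count
    (· ∈ (Set.finite_range ρ).toFinset) (ρ x), (Set.finite_range ρ).toFinset⟩)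
    (fun p _ x => Nat.nth (· ∈ p.2) (p.1 x)) ?_ ?_ ?_ ?_
  · intro ρ hρ
    obtain ⟨hp, hb⟩ := (bounded_finite ω m).mem_toFinset.1 hρ
    set T := (Set.finite_range ρ).toFinset with hT
    have hm : ∀ x, ρ x ∈ T := fun x => by simp [hT]
    have hr : (Set.range fun x => Nat.count (· ∈ T) (ρ x)) = Set.Iio T.card := by
      ext v
      constructor
      · rintro ⟨x, rfl⟩
        exact count_lt_card_finset (hm x)
      · intro hv
        obtain ⟨x, hx⟩ := (Set.finite_range ρ).mem_toFinset.1 (nth_mem_finset hv)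
        exact ⟨x, by simp only [hx]; exact count_nth_finset hv⟩
    simp only [Finset.mem_sigma, mem_packings, Finset.mem_powersetCard]
    refine ⟨⟨?_, isLowerSet_of_range hr⟩, fun v hv => ?_, (height_eq_of_range hr).symm⟩
    · exact (isNatPartition_congr fun x y => count_lt_count_iff_finset (hm x) (hm y)).2 hp
    · obtain ⟨x, rfl⟩ := (Set.finite_range ρ).mem_toFinset.1 hv
      exact Finset.mem_range.2 (hb x)
  · rintro ⟨σ, T⟩ hp
    simp only [Finset.mem_sigma, mem_packings, Finset.mem_powersetCard] at hp
    obtain ⟨⟨hσ, hl⟩, hT, hc⟩ := hp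
    have hlt : ∀ x, σ x < T.card := fun x => hc ▸ lt_height hl x
    refine (bounded_finite ω m).mem_toFinset.2 ⟨?_, fun x => ?_⟩
    · exact (isNatPartition_congr fun x y => nth_lt_nth_iff_finset (hlt x) (hlt y)).2 hσ
    · exact Finset.mem_range.1 (hT (nth_mem_finset (hlt x)))
  · intro ρ hρ
    funext x
    exact Nat.nth_count (by simp)
  · rintro ⟨σ, T⟩ hp
    simp only [Finset.mem_sigma, mem_packings, Finset.mem_powersetCard] at hp
    obtain ⟨⟨hσ, hl⟩, hT, hc⟩ := hp
    have hlt : ∀ x, σ x < T.card := fun x => hc ▸ lt_height hl x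
    have hr : (Set.finite_range fun x => Nat.nth (· ∈ T) (σ x)).toFinset = T := by
      ext v
      rw [Set.Finite.mem_toFinset]
      constructor
      · rintro ⟨x, rfl⟩
        exact nth_mem_finset (hlt x)
      · intro hv
        have h := count_lt_card_finset hv
        rw [hc, ← Set.mem_Iio, ← range_eq_Iio hl] at h
        obtain ⟨x, hx⟩ := h
        exact ⟨x, by simp only [hx]; exact Nat.nth_count hv⟩
    simp only [hr]
    congr 1
    funext x
    exact count_nth_finset (hlt x)

end Packed

/-! ### Partitions of a poset that is covered by two disjoint pieces -/

section Glue

variable {A B R : Type*} {i : A → R} {j : B → R}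

/-- The map on `R` that is given by `σ` on the image of `i` and by `τ` on the image of `j`. -/
def glue (hij : Function.Bijective (Sum.elim i j)) (σ : A → ℕ) (τ : B → ℕ) : R → ℕ :=
  fun r => Sum.elim σ τ ((Equiv.ofBijective _ hij).symm r)

theorem glue_left (hij : Function.Bijective (Sum.elim i j))
    (σ : A → ℕ) (τ : B → ℕ) (a : A) : glue hij σ τ (i a) = σ a := by
  have : (Equiv.ofBijective _ hij).symm (i a) = Sum.inl a := by
    rw [Equiv.symm_apply_eq]; rfl
  rw [glue, this, Sum.elim_inl]

theorem glue_right (hij : Function.Bijective (Sum.elim i j))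
    (σ : A → ℕ) (τ : B → ℕ) (b : B) : glue hij σ τ (j b) = τ b := by
  have : (Equiv.ofBijective _ hij).symm (j b) = Sum.inr b := by
    rw [Equiv.symm_apply_eq]; rfl
  rw [glue, this, Sum.elim_inr]

theorem exists_of_bijective_elim (hij : Function.Bijective (Sum.elim i j))
    (r : R) : (∃ a, i a = r) ∨ ∃ b, j b = r := by
  obtain ⟨x | x, rfl⟩ := hij.2 r
  · exact Or.inl ⟨x, rfl⟩
  · exact Or.inr ⟨x, rfl⟩

theorem eq_glue (hij : Function.Bijective (Sum.elim i j))
    {σ : A → ℕ} {τ : B → ℕ} {ρ : R → ℕ} (h1 : ∀ a, ρ (i a) = σ a)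
    (h2 : ∀ b, ρ (j b) = τ b) : glue hij σ τ = ρ := by
  funext r
  rcases exists_of_bijective_elim hij r with ⟨a, rfl⟩ | ⟨b, rfl⟩
  · rw [glue_left, h1]
  · rw [glue_right, h2]

/-- The values are `[0, l)` and the shifted `[c, c + k)`, which leave no gap as `c ≤ l`. The shift
is `c = l` for strict gluing and `c = l - 1` for one shared value. -/
theorem range_glue_add (hij : Function.Bijective (Sum.elim i j))
    {σ : A → ℕ} {τ : B → ℕ} {k l c : ℕ} (hσ : Set.range σ = Set.Iio k)
    (hτ : Set.range τ = Set.Iio l) (h1 : c ≤ l) (h2 : l ≤ c + k) :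
    Set.range (glue hij (fun a => σ a + c) τ) = Set.Iio (k + c) := by
  ext v
  constructor
  · rintro ⟨r, rfl⟩
    rcases exists_of_bijective_elim hij r with ⟨a, rfl⟩ | ⟨b, rfl⟩
    · rw [glue_left]
      have : σ a ∈ Set.Iio k := hσ ▸ Set.mem_range_self a
      simp at this ⊢
      omega
    · rw [glue_right]
      have : τ b ∈ Set.Iio l := hτ ▸ Set.mem_range_self b
      simp at this ⊢
      omega
  · intro hv
    rw [Set.mem_Iio] at hv
    rcases lt_or_ge v l with h | h
    · obtain ⟨b, rfl⟩ : v ∈ Set.range τ := hτ ▸ h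
      exact ⟨j b, glue_right hij _ _ b⟩
    · obtain ⟨a, ha⟩ : v - c ∈ Set.range σ := hσ ▸ (show v - c < k by omega)
      exact ⟨i a, by rw [glue_left]; omega⟩

theorem isLowerSet_range_right (hij : Function.Bijective (Sum.elim i j))
    {ρ : R → ℕ} (hρ : IsLowerSet (Set.range ρ))
    (hw : ∀ a b, ρ (j b) ≤ ρ (i a)) : IsLowerSet (Set.range (ρ ∘ j)) := by
  rintro _ v hv ⟨b, rfl⟩
  rcases hv.eq_or_lt with rfl | hv
  · exact ⟨b, rfl⟩
  obtain ⟨r, rfl⟩ := hρ hv.le ⟨j b, rfl⟩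
  rcases exists_of_bijective_elim hij r with ⟨a, rfl⟩ | ⟨b', rfl⟩
  · exact absurd hv (hw a b).not_gt
  · exact ⟨b', rfl⟩

theorem isLowerSet_range_left_sub (hij : Function.Bijective (Sum.elim i j))
    {ρ : R → ℕ} {c : ℕ} (hρ : IsLowerSet (Set.range ρ))
    (hc : ∀ a, c ≤ ρ (i a)) (hc' : ∀ b, c ≤ ρ (j b) → ∃ a, ρ (i a) = ρ (j b)) :
    IsLowerSet (Set.range fun a => ρ (i a) - c) := by
  rintro _ v hv ⟨a, rfl⟩
  have ha := hc a
  simp only at hv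
  obtain ⟨r, hr⟩ := hρ (show v + c ≤ ρ (i a) by omega) ⟨i a, rfl⟩
  rcases exists_of_bijective_elim hij r with ⟨a', rfl⟩ | ⟨b', rfl⟩
  · exact ⟨a', by simp only; omega⟩
  · obtain ⟨a', ha'⟩ := hc' b' (by omega)
    exact ⟨a', by simp only; omega⟩

theorem le_of_touching (hij : Function.Bijective (Sum.elim i j))
    {ρ : R → ℕ} [Finite B] [Nonempty B] (hl : IsLowerSet (Set.range ρ))
    (hw : ∀ a b, ρ (j b) ≤ ρ (i a)) (a : A) : height (ρ ∘ j) - 1 ≤ ρ (i a) := by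
  have hjl := isLowerSet_range_right hij hl hw
  have hpos := height_pos (ρ ∘ j)
  obtain ⟨b, hb⟩ : height (ρ ∘ j) - 1 ∈ Set.range (ρ ∘ j) := by
    rw [range_eq_Iio hjl]; exact Nat.sub_lt hpos one_pos
  exact hb ▸ hw a b

variable [PartialOrder A] [PartialOrder B] [Finite A] [Finite B]

theorem EPoly_mul (α : A → ℕ) (β : B → ℕ) : EPoly α * EPoly β =
    ∑ p ∈ packings α ×ˢ packings β, X ^ (height p.1 + height p.2) := by
  rw [EPoly_eq_sum, EPoly_eq_sum, Finset.sum_mul_sum, Finset.sum_product]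
  simp only [pow_add]

/-- Stacking the values on `A` directly above those on `B` adds the heights. -/
theorem sum_strict (hij : Function.Bijective (Sum.elim i j))
    {α : A → ℕ} {β : B → ℕ} (Z : Finset (R → ℕ))
    (hZ : ∀ ρ, ρ ∈ Z ↔ IsLowerSet (Set.range ρ) ∧ IsNatPartition α (ρ ∘ i) ∧
      IsNatPartition β (ρ ∘ j) ∧ ∀ a b, ρ (j b) < ρ (i a)) :
    ∑ ρ ∈ Z, (X : ℝ[X]) ^ height ρ = EPoly α * EPoly β := by
  rw [EPoly_mul]
  symm
  refine Finset.sum_bij' (fun p _ => glue hij (fun a => p.1 a + height p.2) p.2)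
    (fun ρ _ => (fun a => ρ (i a) - height (ρ ∘ j), ρ ∘ j)) ?_ ?_ ?_ ?_ ?_
  · rintro ⟨σ, τ⟩ hp
    simp only [Finset.mem_product, mem_packings] at hp
    obtain ⟨⟨hσ, hσl⟩, hτ, hτl⟩ := hp
    have hr := range_glue_add hij (range_eq_Iio hσl) (range_eq_Iio hτl) le_rfl (by omega)
    refine (hZ _).2 ⟨isLowerSet_of_range hr, ?_, ?_, fun a b => ?_⟩
    · simpa only [Function.comp_def, glue_left, isNatPartition_add_iff] using hσ
    · simpa only [Function.comp_def, glue_right] using hτ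
    · rw [glue_left, glue_right]
      have := lt_height hτl b
      simp only
      omega
  · intro ρ hρ
    obtain ⟨hl, hα, hβ, hs⟩ := (hZ ρ).1 hρ
    have hjl := isLowerSet_range_right hij hl fun a b => (hs a b).le
    have hjr := range_eq_Iio hjl
    have hge : ∀ a, height (ρ ∘ j) ≤ ρ (i a) := by
      intro a
      by_contra! h
      obtain ⟨b, hb⟩ : ρ (i a) ∈ Set.range (ρ ∘ j) := hjr ▸ h
      exact (hb ▸ hs a b).false
    simp only [Finset.mem_product, mem_packings]
    refine ⟨⟨?_, isLowerSet_range_left_sub hij hl hge ?_⟩, hβ, hjl⟩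
    · refine (isNatPartition_congr fun x y => ?_).2 hα
      have := hge x
      have := hge y
      simp only [Function.comp_apply]
      omega
    · intro b hb
      exact absurd hb (lt_height hjl b).not_ge
  · rintro ⟨σ, τ⟩ hp
    simp only [Function.comp_def, glue_left, glue_right]
    simp
  · intro ρ hρ
    obtain ⟨hl, hα, hβ, hs⟩ := (hZ ρ).1 hρ
    have hjl := isLowerSet_range_right hij hl fun a b => (hs a b).le
    refine eq_glue hij (fun a => ?_) fun b => rfl
    have hge : height (ρ ∘ j) ≤ ρ (i a) := by
      by_contra! h
      obtain ⟨b, hb⟩ : ρ (i a) ∈ Set.range (ρ ∘ j) := range_eq_Iio hjl ▸ h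
      exact (hb ▸ hs a b).false
    simp only
    omega
  · rintro ⟨σ, τ⟩ hp
    simp only [Finset.mem_product, mem_packings] at hp
    obtain ⟨⟨hσ, hσl⟩, hτ, hτl⟩ := hp
    have hr := range_glue_add hij (range_eq_Iio hσl) (range_eq_Iio hτl) le_rfl (by omega)
    rw [height_eq_of_range hr]

/-- The top value on `B` equals the bottom value on `A`, so one value is counted twice in the sum of
heights; this is the extra `X`. Nonemptiness keeps `height - 1` from truncating. -/
theorem sum_touching [Nonempty A] [Nonempty B]
    (hij : Function.Bijective (Sum.elim i j)) {α : A → ℕ} {β : B → ℕ} (Z : Finset (R → ℕ))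
    (hZ : ∀ ρ, ρ ∈ Z ↔ IsLowerSet (Set.range ρ) ∧ IsNatPartition α (ρ ∘ i) ∧
      IsNatPartition β (ρ ∘ j) ∧ (∀ a b, ρ (j b) ≤ ρ (i a)) ∧ ∃ a b, ρ (i a) ≤ ρ (j b)) :
    X * ∑ ρ ∈ Z, (X : ℝ[X]) ^ height ρ = EPoly α * EPoly β := by
  rw [EPoly_mul, Finset.mul_sum]
  symm
  refine Finset.sum_bij' (fun p _ => glue hij (fun a => p.1 a + (height p.2 - 1)) p.2)
    (fun ρ _ => (fun a => ρ (i a) - (height (ρ ∘ j) - 1), ρ ∘ j)) ?_ ?_ ?_ ?_ ?_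
  · rintro ⟨σ, τ⟩ hp
    simp only [Finset.mem_product, mem_packings] at hp
    obtain ⟨⟨hσ, hσl⟩, hτ, hτl⟩ := hp
    have h1 := height_pos σ
    have h2 := height_pos τ
    have hr := range_glue_add hij (range_eq_Iio hσl) (range_eq_Iio hτl)
      (Nat.sub_le (height τ) 1) (by omega)
    refine (hZ _).2 ⟨isLowerSet_of_range hr, ?_, ?_, fun a b => ?_, ?_⟩
    · simpa only [Function.comp_def, glue_left, isNatPartition_add_iff] using hσ
    · simpa only [Function.comp_def, glue_right] using hτ
    · rw [glue_left, glue_right]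
      have := lt_height hτl b
      simp only
      omega
    · obtain ⟨a, ha⟩ : 0 ∈ Set.range σ := range_eq_Iio hσl ▸ h1
      obtain ⟨b, hb⟩ : height τ - 1 ∈ Set.range τ := by
        rw [range_eq_Iio hτl]; exact Nat.sub_lt h2 one_pos
      refine ⟨a, b, ?_⟩
      rw [glue_left, glue_right]
      simp only
      omega
  · intro ρ hρ
    obtain ⟨hl, hα, hβ, hs, a₀, b₀, h₀⟩ := (hZ ρ).1 hρ
    have hjl := isLowerSet_range_right hij hl hs
    have hge := le_of_touching hij hl hs
    simp only [Finset.mem_product, mem_packings]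
    refine ⟨⟨?_, isLowerSet_range_left_sub hij hl hge ?_⟩, hβ, hjl⟩
    · refine (isNatPartition_congr fun x y => ?_).2 hα
      have := hge x
      have := hge y
      simp only [Function.comp_apply]
      omega
    · intro b hb
      have h1 := lt_height hjl b
      have h2 := lt_height hjl b₀
      have h3 := hge a₀
      simp only [Function.comp_apply] at h1 h2
      exact ⟨a₀, by omega⟩
  · rintro ⟨σ, τ⟩ hp
    simp only [Function.comp_def, glue_left, glue_right]
    simp
  · intro ρ hρ
    obtain ⟨hl, hα, hβ, hs, -⟩ := (hZ ρ).1 hρ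
    refine eq_glue hij (fun a => ?_) fun b => rfl
    have := le_of_touching hij hl hs a
    simp only
    omega
  · rintro ⟨σ, τ⟩ hp
    simp only [Finset.mem_product, mem_packings] at hp
    obtain ⟨⟨hσ, hσl⟩, hτ, hτl⟩ := hp
    have h1 := height_pos σ
    have h2 := height_pos τ
    have hr := range_glue_add hij (range_eq_Iio hσl) (range_eq_Iio hτl)
      (Nat.sub_le (height τ) 1) (by omega)
    rw [height_eq_of_range hr, ← pow_succ']
    congr 1
    simp only
    omega

variable [PartialOrder R] [Finite R]

theorem EPoly_of_strict (hij : Function.Bijective (Sum.elim i j))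
    {α : A → ℕ} {β : B → ℕ} {μ : R → ℕ}
    (h : ∀ ρ : R → ℕ, IsNatPartition μ ρ ↔ IsNatPartition α (ρ ∘ i) ∧
      IsNatPartition β (ρ ∘ j) ∧ ∀ a b, ρ (j b) < ρ (i a)) :
    EPoly μ = EPoly α * EPoly β := by
  rw [EPoly_eq_sum μ]
  refine sum_strict hij _ fun ρ => ?_
  rw [mem_packings, h, and_comm]

theorem EPoly_of_weak [Nonempty A] [Nonempty B]
    (hij : Function.Bijective (Sum.elim i j)) {α : A → ℕ} {β : B → ℕ} {μ : R → ℕ}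
    (h : ∀ ρ : R → ℕ, IsNatPartition μ ρ ↔ IsNatPartition α (ρ ∘ i) ∧
      IsNatPartition β (ρ ∘ j) ∧ ∀ a b, ρ (j b) ≤ ρ (i a)) :
    X * EPoly μ = (X + 1) * (EPoly α * EPoly β) := by
  classical
  rw [EPoly_eq_sum μ, ← Finset.sum_filter_add_sum_filter_not _
    (fun ρ : R → ℕ => ∀ a b, ρ (j b) < ρ (i a)), mul_add, add_mul, one_mul]
  congr 1
  · rw [sum_strict hij]
    intro ρ
    rw [Finset.mem_filter, mem_packings, h]
    constructor
    · rintro ⟨⟨⟨h1, h2, -⟩, h3⟩, h4⟩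
      exact ⟨h3, h1, h2, h4⟩
    · rintro ⟨h3, h1, h2, h4⟩
      exact ⟨⟨⟨h1, h2, fun a b => (h4 a b).le⟩, h3⟩, h4⟩
  · refine sum_touching hij _ fun ρ => ?_
    rw [Finset.mem_filter, mem_packings, h]
    push Not
    tauto

theorem EPoly_of_disjoint (hij : Function.Bijective (Sum.elim i j))
    {α : A → ℕ} {β : B → ℕ} {μ : R → ℕ}
    (h : ∀ ρ : R → ℕ, IsNatPartition μ ρ ↔ IsNatPartition α (ρ ∘ i) ∧ IsNatPartition β (ρ ∘ j)) :
    EPoly μ = diamond (EPoly β) (EPoly α) := by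
  refine eq_of_chooseEval_eq fun m => ?_
  rw [chooseEval_diamond, chooseEval_EPoly, chooseEval_EPoly, chooseEval_EPoly, ← Nat.cast_mul,
    ← Set.ncard_prod]
  congr 1
  symm
  refine Set.ncard_congr (fun p _ => glue hij p.1 p.2) ?_ ?_ ?_
  · rintro ⟨σ, τ⟩ ⟨⟨hσ, hσb⟩, hτ, hτb⟩
    refine ⟨(h _).2 ⟨?_, ?_⟩, fun r => ?_⟩
    · simpa only [Function.comp_def, glue_left] using hσ
    · simpa only [Function.comp_def, glue_right] using hτ
    · rcases exists_of_bijective_elim hij r with ⟨a, rfl⟩ | ⟨b, rfl⟩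
      · rw [glue_left]; exact hσb a
      · rw [glue_right]; exact hτb b
  · rintro ⟨σ, τ⟩ ⟨σ', τ'⟩ - - he
    have h1 : σ = σ' := funext fun a => by
      have := congrFun he (i a)
      rwa [glue_left, glue_left] at this
    have h2 : τ = τ' := funext fun b => by
      have := congrFun he (j b)
      rwa [glue_right, glue_right] at this
    rw [h1, h2]
  · rintro ρ ⟨hρ, hb⟩
    obtain ⟨h1, h2⟩ := (h ρ).1 hρ
    exact ⟨(ρ ∘ i, ρ ∘ j), ⟨⟨h1, fun a => hb _⟩, h2, fun b => hb _⟩,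
      eq_glue hij (fun _ => rfl) fun _ => rfl⟩

end Glue

/-! ### The zeros of `E`-polynomials are not smaller than `-1` -/

section Sign

universe u

theorem EPoly_of_card_eq_one {P : Type*} [PartialOrder P] (ω : P → ℕ) (h : Nat.card P = 1) :
    EPoly ω = X := by
  have : Finite P := Nat.finite_of_card_ne_zero (by omega)
  obtain ⟨hs, hn⟩ := Nat.card_eq_one_iff_unique.1 h
  rw [EPoly_eq_sum]
  have hσ : ∀ σ ∈ packings ω, σ = fun _ => 0 := by
    intro σ hσ
    obtain ⟨-, hl⟩ := mem_packings.1 hσ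
    funext x
    have h1 := lt_height hl x
    have h2 := height_le_card σ
    omega
  have hr : (Set.range fun _ : P => 0) = Set.Iio 1 := by
    rw [Set.range_const]
    ext v
    simp
  have hmem : (fun _ : P => 0) ∈ packings ω := mem_packings.2
    ⟨⟨fun _ _ _ => le_rfl, fun x y hxy => absurd (Subsingleton.elim x y) hxy.ne⟩,
      isLowerSet_of_range hr⟩
  rw [Finset.sum_eq_single_of_mem _ hmem fun σ h1 h2 => absurd (hσ σ h1) h2,
    height_eq_of_range hr, pow_one]

theorem isNatPartition_iff {P : Type*} [PartialOrder P] {ω σ : P → ℕ} :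
    IsNatPartition ω σ ↔ ∀ x y, x ≤ y → σ y ≤ σ x ∧ (ω y < ω x → σ y < σ x) := by
  constructor
  · rintro ⟨h1, h2⟩ x y hxy
    refine ⟨h1 x y hxy, fun hω => h2 x y (hxy.lt_of_ne ?_) hω⟩
    rintro rfl
    exact hω.false
  · intro h
    exact ⟨fun x y hxy => (h x y hxy).1, fun x y hxy => (h x y hxy.le).2⟩

/-- The partial order generated by a partial order and one additional relation `x < y`. -/
@[reducible] def addRelation {P : Type*} [PartialOrder P] (x y : P) (h : ¬ y ≤ x) :
    PartialOrder P where
  le a b := a ≤ b ∨ (a ≤ x ∧ y ≤ b)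
  lt a b := (a ≤ b ∨ (a ≤ x ∧ y ≤ b)) ∧ ¬ (b ≤ a ∨ (b ≤ x ∧ y ≤ a))
  lt_iff_le_not_ge _ _ := Iff.rfl
  le_refl a := Or.inl le_rfl
  le_trans a b c := by
    rintro (h1 | ⟨h1, h1'⟩) (h2 | ⟨h2, h2'⟩)
    · exact Or.inl (h1.trans h2)
    · exact Or.inr ⟨h1.trans h2, h2'⟩
    · exact Or.inr ⟨h1, h1'.trans h2⟩
    · exact absurd (h1'.trans h2) h
  le_antisymm a b := by
    rintro (h1 | ⟨h1, h1'⟩) (h2 | ⟨h2, h2'⟩)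
    · exact le_antisymm h1 h2
    · exact absurd ((h2'.trans h1).trans h2) h
    · exact absurd ((h1'.trans h2).trans h1) h
    · exact absurd (h1'.trans h2) h

/-- A label descent along `a ≤ x < y ≤ b` must occur in one of the three steps, and that step
supplies the strict inequality. -/
theorem isNatPartition_addRelation {P : Type*} [PartialOrder P] {ω σ : P → ℕ} {x y : P}
    (h : ¬ y ≤ x) : @IsNatPartition P (addRelation x y h) ω σ ↔
      IsNatPartition ω σ ∧ σ y ≤ σ x ∧ (ω y < ω x → σ y < σ x) := by
  rw [@isNatPartition_iff P (addRelation x y h), isNatPartition_iff]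
  constructor
  · intro H
    exact ⟨fun a b hab => H a b (Or.inl hab), H x y (Or.inr ⟨le_rfl, le_rfl⟩)⟩
  · rintro ⟨H, h1, h2⟩ a b (hab | ⟨ha, hb⟩)
    · exact H a b hab
    · obtain ⟨h3, h4⟩ := H a x ha
      obtain ⟨h5, h6⟩ := H y b hb
      refine ⟨by omega, fun hω => ?_⟩
      by_cases c1 : ω x < ω a
      · have := h4 c1; omega
      · by_cases c2 : ω b < ω y
        · have := h6 c2; omega
        · have := h2 (by omega); omega

/-- Either `σ y ≤ σ x` or `σ x < σ y`. As `ω x < ω y`, these are exactly the conditions imposed by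
adding `x < y` or `y < x`. -/
theorem EPoly_eq_add {P : Type*} [PartialOrder P] [Finite P] {ω : P → ℕ} {x y : P}
    (hxy : ¬ x ≤ y) (hyx : ¬ y ≤ x) (hω : ω x < ω y) :
    EPoly ω = @EPoly P (addRelation x y hyx) ω + @EPoly P (addRelation y x hxy) ω := by
  classical
  rw [EPoly_eq_sum, @EPoly_eq_sum P (addRelation x y hyx), @EPoly_eq_sum P (addRelation y x hxy),
    ← Finset.sum_filter_add_sum_filter_not _ (fun σ : P → ℕ => σ y ≤ σ x)]
  congr 1
  · congr 1
    ext σ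
    rw [Finset.mem_filter, mem_packings, @mem_packings P (addRelation x y hyx),
      isNatPartition_addRelation]
    have : ω y < ω x → σ y < σ x := fun h => absurd h hω.not_gt
    tauto
  · congr 1
    ext σ
    rw [Finset.mem_filter, mem_packings, @mem_packings P (addRelation y x hxy),
      isNatPartition_addRelation, not_le]
    have : σ x < σ y → σ x ≤ σ y := le_of_lt
    tauto

/-- Removing the least element of a chain removes a factor `X` or `X + 1`, and both are negative at
`y < -1`. -/
theorem EPoly_eval_of_total (n : ℕ) : ∀ (P : Type u) [PartialOrder P] [Finite P] (ω : P → ℕ),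
    Function.Injective ω → (∀ a b : P, a ≤ b ∨ b ≤ a) → Nat.card P = n → ∀ y : ℝ, y < -1 →
      0 < (-1) ^ n * (EPoly ω).eval y := by
  induction n with
  | zero =>
    intro P _ _ ω _ _ hc y _
    have : IsEmpty P := by
      rcases Nat.card_eq_zero.1 hc with h | h
      · exact h
      · exact absurd ‹Finite P› (not_finite_iff_infinite.2 h)
    rw [EPoly_of_isEmpty]
    simp
  | succ n ih =>
    intro P _ _ ω hω htot hc y hy
    have hleast : ∀ (Q : Type u) [PartialOrder Q] [Finite Q] [Nonempty Q],
        (∀ a b : Q, a ≤ b ∨ b ≤ a) → ∃ m : Q, ∀ a, m ≤ a := by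
      intro Q _ _ _ ht
      obtain ⟨m, hm⟩ := Finite.exists_min (fun q : Q => {r : Q | r ≤ q}.ncard)
      refine ⟨m, fun a => (ht m a).elim id fun ham => ?_⟩
      have hsub : {r : Q | r ≤ a} ⊆ {r : Q | r ≤ m} := fun r hr => le_trans hr ham
      have := Set.eq_of_subset_of_ncard_le hsub (hm a) (Set.toFinite _)
      have hmm : m ∈ {r : Q | r ≤ m} := le_rfl
      rw [← this] at hmm
      exact hmm
    have : Nonempty P := (Nat.card_pos_iff.1 (by omega : 0 < Nat.card P)).1
    obtain ⟨m, hm⟩ := hleast P htot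
    have hij : Function.Bijective
        (Sum.elim (fun _ : PUnit.{1} => m) (Subtype.val : {q : P // q ≠ m} → P)) := by
      constructor
      · rintro (a | a) (b | b) hab
        · rfl
        · exact absurd hab.symm b.2
        · exact absurd hab a.2
        · exact congrArg Sum.inr (Subtype.ext hab)
      · intro r
        by_cases hr : r = m
        · exact ⟨Sum.inl PUnit.unit, hr.symm⟩
        · exact ⟨Sum.inr ⟨r, hr⟩, rfl⟩
    have hcard : Nat.card {q : P // q ≠ m} = n := by
      have := Nat.card_congr (Equiv.ofBijective _ hij)
      rw [Nat.card_sum, hc, Nat.card_unique] at this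
      omega
    have htot' : ∀ a b : {q : P // q ≠ m}, a ≤ b ∨ b ≤ a := fun a b => htot a b
    have hrest := ih {q : P // q ≠ m} (deleteLabel ω m)
      (fun a b hab => Subtype.ext (hω hab)) htot' hcard y hy
    have hone : EPoly (fun _ : PUnit.{1} => 0) = X := EPoly_of_card_eq_one _ (by simp)
    have hpunit : ∀ σ : PUnit.{1} → ℕ, IsNatPartition (fun _ => 0) σ := fun σ =>
      ⟨fun _ _ _ => le_rfl, fun _ _ _ h => absurd h (lt_irrefl _)⟩
    have hsplit : ∀ ρ : P → ℕ, IsNatPartition ω ρ ↔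
        IsNatPartition (deleteLabel ω m) (ρ ∘ Subtype.val) ∧
          ∀ b : {q : P // q ≠ m}, ρ b ≤ ρ m ∧ (ω b < ω m → ρ b < ρ m) := by
      intro ρ
      simp only [isNatPartition_iff]
      constructor
      · exact fun H => ⟨fun a b hab => H a b hab, fun b => H m b (hm b)⟩
      · rintro ⟨H1, H2⟩ a b hab
        by_cases ha : a = m
        · subst ha
          by_cases hb : b = a
          · subst hb
            exact ⟨le_rfl, fun h => absurd h (lt_irrefl _)⟩
          · exact H2 ⟨b, hb⟩
        · have hb : b ≠ m := by
            rintro rfl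
            exact ha (le_antisymm hab (hm a))
          exact H1 ⟨a, ha⟩ ⟨b, hb⟩ hab
    have hstrict : (∀ ρ : P → ℕ, IsNatPartition ω ρ ↔ IsNatPartition (fun _ => 0)
          (ρ ∘ fun _ : PUnit.{1} => m) ∧ IsNatPartition (deleteLabel ω m) (ρ ∘ Subtype.val) ∧
          ∀ (_ : PUnit.{1}) (b : {q : P // q ≠ m}), ρ b < ρ m) →
        0 < (-1) ^ (n + 1) * (EPoly ω).eval y := by
      intro h
      rw [EPoly_of_strict hij h, hone, eval_mul, eval_X, pow_succ]
      nlinarith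
    by_cases hne : Nonempty {q : P // q ≠ m}
    · obtain ⟨m', hm'⟩ := hleast {q : P // q ≠ m} htot'
      rcases lt_or_gt_of_ne fun h => m'.2 (hω h) with hlt | hlt
      · refine hstrict fun ρ => ?_
        rw [hsplit]
        constructor
        · rintro ⟨h1, h2⟩
          exact ⟨hpunit _, h1, fun _ b => (h1.1 m' b (hm' b)).trans_lt ((h2 m').2 hlt)⟩
        · rintro ⟨-, h1, h2⟩
          exact ⟨h1, fun b => ⟨(h2 ⟨⟩ b).le, fun _ => h2 ⟨⟩ b⟩⟩
      · have h := EPoly_of_weak hij (α := fun _ => 0) (β := deleteLabel ω m) (μ := ω) (by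
          intro ρ
          rw [hsplit]
          constructor
          · rintro ⟨h1, h2⟩
            exact ⟨hpunit _, h1, fun _ b => (h2 b).1⟩
          · rintro ⟨-, h1, h2⟩
            refine ⟨h1, fun b => ⟨h2 ⟨⟩ b, fun hb => ?_⟩⟩
            exact ((isNatPartition_iff.1 h1 m' b (hm' b)).2 (hb.trans hlt)).trans_le (h2 ⟨⟩ m'))
        rw [hone, ← mul_assoc, mul_comm (X + 1) X, mul_assoc] at h
        rw [mul_left_cancel₀ X_ne_zero h, eval_mul, pow_succ]
        simp only [eval_add, eval_X, eval_one]
        nlinarith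
    · refine hstrict fun ρ => ?_
      rw [hsplit]
      have : IsEmpty {q : P // q ≠ m} := not_nonempty_iff.1 hne
      exact ⟨fun h => ⟨hpunit _, h.1, fun _ b => isEmptyElim b⟩,
        fun h => ⟨h.2.1, fun b => isEmptyElim b⟩⟩

/-- The order varies while the set stays fixed. Each split of an incomparable pair lowers the number
of non-relations, until only chains remain. -/
theorem EPoly_eval_sign {P : Type u} [Finite P] {ω : P → ℕ} (hω : Function.Injective ω) {y : ℝ}
    (hy : y < -1) (n : ℕ) : ∀ _ : PartialOrder P, {p : P × P | ¬ p.1 ≤ p.2}.ncard = n →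
      0 < (-1) ^ Nat.card P * (EPoly ω).eval y := by
  induction n using Nat.strong_induction_on with
  | _ n ih =>
    intro inst hn
    by_cases htot : ∀ a b : P, a ≤ b ∨ b ≤ a
    · exact EPoly_eval_of_total _ P ω hω htot rfl y hy
    · push Not at htot
      have hadd : ∀ (x z : P) (hxz : ¬ x ≤ z) (hzx : ¬ z ≤ x),
          0 < (-1) ^ Nat.card P * (@EPoly P (addRelation x z hzx) ω).eval y := by
        intro x z hxz hzx
        refine ih _ ?_ (addRelation x z hzx) rfl
        rw [← hn]
        refine Set.ncard_lt_ncard ?_ (Set.toFinite _)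
        refine ⟨fun p hp h => hp (Or.inl h), fun hsub => ?_⟩
        exact hsub (show (x, z) ∈ {p : P × P | ¬ p.1 ≤ p.2} from hxz) (Or.inr ⟨le_rfl, le_rfl⟩)
      obtain ⟨x, z, hxz, hzx⟩ := htot
      have hne : ω x ≠ ω z := fun h => hxz (hω h).le
      rcases lt_or_gt_of_ne hne with hlt | hlt
      · rw [EPoly_eq_add hxz hzx hlt, eval_add, mul_add]
        exact add_pos (hadd x z hxz hzx) (hadd z x hzx hxz)
      · rw [EPoly_eq_add hzx hxz hlt, eval_add, mul_add]
        exact add_pos (hadd z x hzx hxz) (hadd x z hxz hzx)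

theorem EPoly_root_mem {P : Type*} [PartialOrder P] [Finite P] {ω : P → ℕ}
    (hω : Function.Injective ω) {r : ℝ} (hr : (EPoly ω).eval r = 0) : -1 ≤ r ∧ r ≤ 0 := by
  constructor
  · by_contra! h
    have := EPoly_eval_sign hω h _ inferInstance rfl
    rw [hr, mul_zero] at this
    exact this.false
  · by_contra! h
    have h1 : 0 < (EPoly ω).eval r := by
      rw [eval_eq_sum_range]
      refine Finset.sum_pos' (fun k _ => mul_nonneg (EPoly_coeff_nonneg ω k) (by positivity)) ?_
      refine ⟨(EPoly ω).natDegree, by simp, ?_⟩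
      have := EPoly_leadingCoeff_pos ω
      exact mul_pos this (by positivity)
    exact h1.ne' hr

end Sign

/-! ### Stability of `UpperRatio` under products -/

theorem UpperRatio.mul_right {g f h : ℝ[X]} (H : UpperRatio g f)
    (hh : ∀ z : ℂ, 0 < z.im → aeval z h ≠ 0) : UpperRatio (g * h) (f * h) := by
  intro z hz
  rw [map_mul, map_mul, mul_div_mul_right _ _ (hh z hz)]
  exact H z hz

theorem ne_zero_of_im_pos {z : ℂ} (hz : 0 < z.im) : z ≠ 0 := by
  rintro rfl
  simp at hz

theorem UpperRatio.of_X_mul_eq {g f h M N : ℝ[X]} (H : UpperRatio g f)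
    (hh : ∀ z : ℂ, 0 < z.im → aeval z h ≠ 0) (hM : X * M = (X + 1) * (f * h))
    (hN : X * N = (X + 1) * (g * h)) : UpperRatio N M := by
  intro z hz
  have h1 := congrArg (aeval z) hM
  have h2 := congrArg (aeval z) hN
  simp only [map_mul, map_add, aeval_X, map_one] at h1 h2
  have hz0 := ne_zero_of_im_pos hz
  have hz1 : z + 1 ≠ 0 := ne_zero_of_im_pos (by simpa using hz)
  have := H.mul_right hh z hz
  rwa [map_mul, map_mul, ← mul_div_mul_left _ _ hz1, ← h1, ← h2, mul_div_mul_left _ _ hz0] at this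

/-- This serves a one-point summand, whose deletion leaves an empty part to which the weak product
formula does not apply. The quotient is then `z + 1`. -/
theorem UpperRatio.of_X_mul_eq_X {h M : ℝ[X]} (hh : ∀ z : ℂ, 0 < z.im → aeval z h ≠ 0)
    (hM : X * M = (X + 1) * (X * h)) : UpperRatio h M := by
  intro z hz
  have hM' : M = (X + 1) * h := mul_left_cancel₀ X_ne_zero (by rw [hM]; ring)
  rw [hM', map_mul, mul_div_cancel_right₀ _ (hh z hz)]
  simpa using hz

theorem UpperRatio.add_mul_ne_zero {g f : ℝ[X]} (H : UpperRatio g f) {ζ z : ℂ} (hζ : 0 ≤ ζ.im)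
    (hz : 0 < z.im) : aeval z f + ζ * aeval z g ≠ 0 := by
  intro h
  have h0 := H.ne_zero_left hz
  have h1 : aeval z f / aeval z g = -ζ := by
    rw [div_eq_iff h0]
    linear_combination h
  have := H z hz
  rw [h1, Complex.neg_im] at this
  linarith

/-- No combination `f + ζ g` with `0 ≤ ζ.im` vanishes in the upper half plane, and by linearity the
same holds for its image. A value of the image quotient with nonpositive imaginary part would be
`-ζ` for such a `ζ`. -/
theorem UpperRatio.diamond {g f h : ℝ[X]} (H : UpperRatio g f) (h0 : h ≠ 0) (hs : h.Splits)
    (hr : ∀ r, h.eval r = 0 → -1 ≤ r ∧ r ≤ 0) :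
    UpperRatio (diamond h g) (diamond h f) := by
  have hinj : Function.Injective (algebraMap ℝ ℂ) := (algebraMap ℝ ℂ).injective
  have hne : h.map (algebraMap ℝ ℂ) ≠ 0 := (Polynomial.map_ne_zero_iff hinj).2 h0
  have hroots : ∀ z, (h.map (algebraMap ℝ ℂ)).eval z = 0 →
      ∃ r : ℝ, z = r ∧ -1 ≤ r ∧ r ≤ 0 := by
    intro z hz
    have hmem : z ∈ (h.map (algebraMap ℝ ℂ)).roots := (mem_roots hne).2 hz
    rw [hs.roots_map, Multiset.mem_map] at hmem
    obtain ⟨r, hrr, rfl⟩ := hmem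
    exact ⟨r, rfl, hr r (mem_roots'.1 hrr).2⟩
  have hmap : ∀ (p : ℝ[X]) (z : ℂ), aeval z (LabelledPoset.diamond h p) =
      (LabelledPoset.diamond (h.map (algebraMap ℝ ℂ)) (p.map (algebraMap ℝ ℂ))).eval z := by
    intro p z
    rw [← map_diamond _ hinj, eval_map_algebraMap]
  intro z hz
  have hg0 : aeval z (LabelledPoset.diamond h g) ≠ 0 := by
    rw [hmap]
    refine eval_diamond_ne_zero hne hroots (fun w hw => ?_) hz
    rw [eval_map_algebraMap]
    exact H.ne_zero_left hw
  by_contra! hle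
  set ζ := -(aeval z (LabelledPoset.diamond h f) / aeval z (LabelledPoset.diamond h g)) with hζ
  have hζ0 : 0 ≤ ζ.im := by rw [hζ, Complex.neg_im]; linarith
  have key := eval_diamond_ne_zero (f := f.map (algebraMap ℝ ℂ) + ζ • g.map (algebraMap ℝ ℂ))
    hne hroots (fun w hw => by
      rw [eval_add, eval_smul, eval_map_algebraMap, eval_map_algebraMap]
      exact H.add_mul_ne_zero hζ0 hw) hz
  rw [map_add, map_smul, eval_add, eval_smul, ← hmap, ← hmap, hζ, smul_eq_mul, neg_mul,
    div_mul_cancel₀ _ hg0, add_neg_cancel] at key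
  exact key rfl

/-! ### The class `𝓘` in terms of the upper half plane -/

theorem card_ne_add_one {P : Type*} [Finite P] (x : P) :
    Nat.card {y : P // y ≠ x} + 1 = Nat.card P := by
  classical
  have := Fintype.ofFinite P
  have hpos : 0 < Fintype.card P := Fintype.card_pos_iff.2 ⟨x⟩
  rw [Nat.card_eq_fintype_card, Nat.card_eq_fintype_card, Fintype.card_subtype_compl,
    Fintype.card_subtype_eq]
  omega

theorem InClassI.upperRatio {P : Type*} [PartialOrder P] {ω : P → ℕ} (h : InClassI ω) (x : P) :
    UpperRatio (EPoly (deleteLabel ω x)) (EPoly ω) := by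
  have := h.finite
  exact UpperRatio.of_interlaces (h.interlaces x) (EPoly_leadingCoeff_pos _)
    (EPoly_leadingCoeff_pos _)

/-- Real-rootedness comes for free from any one deletion, so only the empty poset needs a separate
argument. -/
theorem InClassI.of_upperRatio {P : Type*} [PartialOrder P] [Finite P] {ω : P → ℕ}
    (hω : Function.Injective ω)
    (h : ∀ x, UpperRatio (EPoly (deleteLabel ω x)) (EPoly ω)) : InClassI ω := by
  have hr : RealRooted (EPoly ω) := by
    rcases isEmpty_or_nonempty P with hP | ⟨⟨x⟩⟩
    · rw [EPoly_of_isEmpty]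
      exact Splits.one
    · exact splits_of_upper_ne_zero fun z hz => (h x).ne_zero_right hz
  refine ⟨‹_›, hω, hr, fun x => ?_⟩
  refine Interlaces.of_upperRatio (h x) (splits_of_upper_ne_zero fun z hz => (h x).ne_zero_left hz)
    hr (EPoly_leadingCoeff_pos _) (EPoly_leadingCoeff_pos _) ?_
  rw [EPoly_natDegree, EPoly_natDegree, card_ne_add_one]

theorem InClassI.aeval_ne_zero {P : Type*} [PartialOrder P] {ω : P → ℕ} (h : InClassI ω) (z : ℂ)
    (hz : 0 < z.im) : aeval z (EPoly ω) ≠ 0 := by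
  have := h.finite
  exact aeval_ne_zero_of_splits h.realRooted (EPoly_ne_zero ω) hz

theorem InClassI.upperRatio_diamond {P : Type*} [PartialOrder P] {ω : P → ℕ} (h : InClassI ω)
    {g f : ℝ[X]} (H : UpperRatio g f) :
    UpperRatio (diamond (EPoly ω) g) (diamond (EPoly ω) f) := by
  have := h.finite
  exact H.diamond (EPoly_ne_zero ω) h.realRooted fun r hr => EPoly_root_mem h.injective hr

/-! ### Labelled posets that are covered by two disjoint labelled subposets -/

/-- The labelled poset `(R, μ)` is the disjoint union of the images of `i` and `j`, and these maps
preserve and reflect the orders and the label orders. -/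
structure IsSplit {A B R : Type*} [PartialOrder A] [PartialOrder B] [PartialOrder R]
    (α : A → ℕ) (β : B → ℕ) (μ : R → ℕ) (i : A → R) (j : B → R) : Prop where
  bijective : Function.Bijective (Sum.elim i j)
  le_left : ∀ a a', i a ≤ i a' ↔ a ≤ a'
  le_right : ∀ b b', j b ≤ j b' ↔ b ≤ b'
  lt_left : ∀ a a', μ (i a) < μ (i a') ↔ α a < α a'
  lt_right : ∀ b b', μ (j b) < μ (j b') ↔ β b < β b'

namespace IsSplit

variable {A B R : Type*} [PartialOrder A] [PartialOrder B] [PartialOrder R]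
  {α : A → ℕ} {β : B → ℕ} {μ : R → ℕ} {i : A → R} {j : B → R}

theorem symm (h : IsSplit α β μ i j) : IsSplit β α μ j i where
  bijective := by
    have : Sum.elim j i = Sum.elim i j ∘ Sum.swap := by
      funext x
      cases x <;> rfl
    rw [this]
    exact h.bijective.comp (Equiv.sumComm B A).bijective
  le_left := h.le_right
  le_right := h.le_left
  lt_left := h.lt_right
  lt_right := h.lt_left

theorem finite [Finite A] [Finite B] (h : IsSplit α β μ i j) : Finite R :=
  Finite.of_surjective _ h.bijective.2

theorem left_injective (h : IsSplit α β μ i j) : Function.Injective i :=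
  h.bijective.1.comp Sum.inl_injective

theorem right_ne_left (h : IsSplit α β μ i j) (a : A) (b : B) : j b ≠ i a := fun hab =>
  Sum.inr_ne_inl (h.bijective.1 (a₁ := Sum.inr b) (a₂ := Sum.inl a) hab)

theorem delete_left (h : IsSplit α β μ i j) (x : A) :
    IsSplit (deleteLabel α x) β (deleteLabel μ (i x))
      (fun a => ⟨i a, fun e => a.2 (h.left_injective e)⟩) (fun b => ⟨j b, h.right_ne_left x b⟩) where
  bijective := by
    constructor
    · rintro (a | a) (b | b) hab
      · exact congrArg Sum.inl (Subtype.ext (h.left_injective (congrArg Subtype.val hab)))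
      · exact absurd (congrArg Subtype.val hab).symm (h.right_ne_left _ _)
      · exact absurd (congrArg Subtype.val hab) (h.right_ne_left _ _)
      · exact congrArg Sum.inr (h.symm.left_injective (congrArg Subtype.val hab))
    · rintro ⟨r, hr⟩
      rcases exists_of_bijective_elim h.bijective r with ⟨a, rfl⟩ | ⟨b, rfl⟩
      · exact ⟨Sum.inl ⟨a, fun e => hr (e ▸ rfl)⟩, rfl⟩
      · exact ⟨Sum.inr b, rfl⟩
  le_left a a' := h.le_left a a'
  le_right b b' := h.le_right b b'
  lt_left a a' := h.lt_left a a'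
  lt_right b b' := h.lt_right b b'

theorem delete_right (h : IsSplit α β μ i j) (y : B) :
    IsSplit α (deleteLabel β y) (deleteLabel μ (j y)) (fun a => ⟨i a, h.symm.right_ne_left y a⟩)
      (fun b => ⟨j b, fun e => b.2 (h.symm.left_injective e)⟩) :=
  (h.symm.delete_left y).symm

theorem inClassI (h : IsSplit α β μ i j) [Finite A] [Finite B] (hμ : Function.Injective μ)
    (hl : ∀ a, UpperRatio (EPoly (deleteLabel μ (i a))) (EPoly μ))
    (hr : ∀ b, UpperRatio (EPoly (deleteLabel μ (j b))) (EPoly μ)) : InClassI μ := by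
  have := h.finite
  refine InClassI.of_upperRatio hμ fun r => ?_
  rcases exists_of_bijective_elim h.bijective r with ⟨a, rfl⟩ | ⟨b, rfl⟩
  · exact hl a
  · exact hr b

theorem isNatPartition_disjoint (h : IsSplit α β μ i j) (h1 : ∀ a b, ¬ i a ≤ j b)
    (h2 : ∀ a b, ¬ j b ≤ i a) (ρ : R → ℕ) :
    IsNatPartition μ ρ ↔ IsNatPartition α (ρ ∘ i) ∧ IsNatPartition β (ρ ∘ j) := by
  simp only [isNatPartition_iff, (Equiv.ofBijective _ h.bijective).surjective.forall, Sum.forall,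
    Equiv.ofBijective_apply, Sum.elim_inl, Sum.elim_inr, h.le_left, h.le_right, h.lt_left,
    h.lt_right, h1, h2, Function.comp_apply]
  simp

theorem isNatPartition_ordinal (h : IsSplit α β μ i j) (h1 : ∀ a b, i a ≤ j b)
    (h2 : ∀ a b, ¬ j b ≤ i a) (ρ : R → ℕ) :
    IsNatPartition μ ρ ↔ IsNatPartition α (ρ ∘ i) ∧ IsNatPartition β (ρ ∘ j) ∧
      ∀ a b, ρ (j b) ≤ ρ (i a) ∧ (μ (j b) < μ (i a) → ρ (j b) < ρ (i a)) := by
  simp only [isNatPartition_iff, (Equiv.ofBijective _ h.bijective).surjective.forall, Sum.forall,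
    Equiv.ofBijective_apply, Sum.elim_inl, Sum.elim_inr, h.le_left, h.le_right, h.lt_left,
    h.lt_right, h1, h2, Function.comp_apply, forall_true_left, forall_and, false_imp_iff,
    imp_true_iff]
  tauto

/-! ### `E`-polynomials and membership in `𝓘` for split labelled posets -/

variable [Finite A] [Finite B]

theorem EPoly_disjoint (h : IsSplit α β μ i j) (h1 : ∀ a b, ¬ i a ≤ j b)
    (h2 : ∀ a b, ¬ j b ≤ i a) : EPoly μ = diamond (EPoly β) (EPoly α) := by
  have := h.finite
  exact EPoly_of_disjoint h.bijective (h.isNatPartition_disjoint h1 h2)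

theorem EPoly_ordinal_strict (h : IsSplit α β μ i j) (h1 : ∀ a b, i a ≤ j b)
    (h2 : ∀ a b, ¬ j b ≤ i a) (h3 : ∀ a b, μ (j b) < μ (i a)) :
    EPoly μ = EPoly α * EPoly β := by
  have := h.finite
  refine EPoly_of_strict h.bijective fun ρ => ?_
  rw [h.isNatPartition_ordinal h1 h2]
  simp only [h3, forall_true_left]
  refine and_congr_right fun _ => and_congr_right fun _ => forall₂_congr fun a b => ?_
  exact ⟨fun h => h.2, fun h => ⟨h.le, h⟩⟩

theorem EPoly_ordinal_weak [Nonempty A] [Nonempty B] (h : IsSplit α β μ i j)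
    (h1 : ∀ a b, i a ≤ j b) (h2 : ∀ a b, ¬ j b ≤ i a) (h3 : ∀ a b, μ (i a) < μ (j b)) :
    X * EPoly μ = (X + 1) * (EPoly α * EPoly β) := by
  have := h.finite
  refine EPoly_of_weak h.bijective fun ρ => ?_
  rw [h.isNatPartition_ordinal h1 h2]
  simp only [(h3 _ _).not_gt, false_imp_iff, and_true]

theorem inClassI_disjoint (h : IsSplit α β μ i j) (hμ : Function.Injective μ)
    (hα : InClassI α) (hβ : InClassI β) (h1 : ∀ a b, ¬ i a ≤ j b) (h2 : ∀ a b, ¬ j b ≤ i a) :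
    InClassI μ := by
  refine h.inClassI hμ (fun a => ?_) fun b => ?_
  · rw [h.EPoly_disjoint h1 h2, (h.delete_left a).EPoly_disjoint (fun _ _ => h1 _ _)
      fun _ _ => h2 _ _]
    exact hβ.upperRatio_diamond (hα.upperRatio a)
  -- Exchanging the parts puts the summand with the deleted element into the linear argument of
  -- `diamond`.
  · rw [h.symm.EPoly_disjoint (fun a b => h2 b a) fun a b => h1 b a,
      (h.delete_right b).symm.EPoly_disjoint (fun _ _ => h2 _ _) fun _ _ => h1 _ _]
    exact hα.upperRatio_diamond (hβ.upperRatio b)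

theorem inClassI_ordinal_strict (h : IsSplit α β μ i j) (hμ : Function.Injective μ)
    (hα : InClassI α) (hβ : InClassI β) (h1 : ∀ a b, i a ≤ j b) (h2 : ∀ a b, ¬ j b ≤ i a)
    (h3 : ∀ a b, μ (j b) < μ (i a)) : InClassI μ := by
  refine h.inClassI hμ (fun a => ?_) fun b => ?_
  · rw [h.EPoly_ordinal_strict h1 h2 h3, (h.delete_left a).EPoly_ordinal_strict
      (fun _ _ => h1 _ _) (fun _ _ => h2 _ _) fun _ _ => h3 _ _]
    exact (hα.upperRatio a).mul_right hβ.aeval_ne_zero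
  · rw [h.EPoly_ordinal_strict h1 h2 h3, (h.delete_right b).EPoly_ordinal_strict
      (fun _ _ => h1 _ _) (fun _ _ => h2 _ _) fun _ _ => h3 _ _, mul_comm (EPoly α),
      mul_comm (EPoly α)]
    exact (hβ.upperRatio b).mul_right hα.aeval_ne_zero

theorem inClassI_ordinal_weak (h : IsSplit α β μ i j) (hμ : Function.Injective μ)
    (hα : InClassI α) (hβ : InClassI β) (h1 : ∀ a b, i a ≤ j b) (h2 : ∀ a b, ¬ j b ≤ i a)
    (h3 : ∀ a b, μ (i a) < μ (j b)) : InClassI μ := by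
  -- With an empty summand the label condition is vacuous, and the strict product formula applies.
  rcases isEmpty_or_nonempty A with hA | hA
  · exact h.inClassI_ordinal_strict hμ hα hβ h1 h2 fun a => isEmptyElim a
  rcases isEmpty_or_nonempty B with hB | hB
  · exact h.inClassI_ordinal_strict hμ hα hβ h1 h2 fun _ b => isEmptyElim b
  have hE := h.EPoly_ordinal_weak h1 h2 h3
  refine h.inClassI hμ (fun a => ?_) fun b => ?_
  · rcases isEmpty_or_nonempty {a' : A // a' ≠ a} with he | he
    · have hc := card_ne_add_one a
      rw [Nat.card_of_isEmpty] at hc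
      rw [(h.delete_left a).EPoly_ordinal_strict (fun _ _ => h1 _ _) (fun _ _ => h2 _ _)
        fun a' => isEmptyElim a', EPoly_of_isEmpty, one_mul]
      rw [EPoly_of_card_eq_one α hc.symm] at hE
      exact UpperRatio.of_X_mul_eq_X hβ.aeval_ne_zero hE
    · exact (hα.upperRatio a).of_X_mul_eq hβ.aeval_ne_zero hE ((h.delete_left a).EPoly_ordinal_weak
        (fun _ _ => h1 _ _) (fun _ _ => h2 _ _) fun _ _ => h3 _ _)
  · rw [mul_comm (EPoly α)] at hE
    rcases isEmpty_or_nonempty {b' : B // b' ≠ b} with he | he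
    · have hc := card_ne_add_one b
      rw [Nat.card_of_isEmpty] at hc
      rw [(h.delete_right b).EPoly_ordinal_strict (fun _ _ => h1 _ _) (fun _ _ => h2 _ _)
        fun _ b' => isEmptyElim b', EPoly_of_isEmpty (deleteLabel β b), mul_one]
      rw [EPoly_of_card_eq_one β hc.symm] at hE
      exact UpperRatio.of_X_mul_eq_X hα.aeval_ne_zero hE
    · refine (hβ.upperRatio b).of_X_mul_eq hα.aeval_ne_zero hE ?_
      rw [mul_comm (EPoly (deleteLabel β b))]
      exact (h.delete_right b).EPoly_ordinal_weak (fun _ _ => h1 _ _) (fun _ _ => h2 _ _)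
        fun _ _ => h3 _ _

end IsSplit

/-! ### Ordinal sums and disjoint unions as splits -/

theorem lt_iff_lt_of_forall_lt {P S : Type*} {ω : P → ℕ} {μ : S → ℕ} {i : P → S}
    (hω : Function.Injective ω) (h : ∀ x y, ω x < ω y → μ (i x) < μ (i y)) (x y : P) :
    μ (i x) < μ (i y) ↔ ω x < ω y := by
  refine ⟨fun hlt => ?_, h x y⟩
  by_contra! hle
  rcases hle.eq_or_lt with he | hl
  · rw [hω he] at hlt
    exact hlt.false
  · exact (hlt.trans (h y x hl)).false

variable {P Q : Type*} [PartialOrder P] [PartialOrder Q] {ω : P → ℕ} {ν : Q → ℕ}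

theorem isSplit_lex {μ : P ⊕ₗ Q → ℕ} (hω : Function.Injective ω) (hν : Function.Injective ν)
    (hl : ∀ x y : P, ω x < ω y → μ (Sum.inlₗ x) < μ (Sum.inlₗ y))
    (hr : ∀ x y : Q, ν x < ν y → μ (Sum.inrₗ x) < μ (Sum.inrₗ y)) :
    IsSplit ω ν μ (fun x => Sum.inlₗ x) (fun y => Sum.inrₗ y) where
  bijective := by
    have : Sum.elim (fun x : P => (Sum.inlₗ x : P ⊕ₗ Q)) (fun y => Sum.inrₗ y) = toLex := by
      funext x
      cases x <;> rfl
    rw [this]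
    exact toLex.bijective
  le_left _ _ := Sum.Lex.inl_le_inl_iff
  le_right _ _ := Sum.Lex.inr_le_inr_iff
  lt_left := lt_iff_lt_of_forall_lt hω hl
  lt_right := lt_iff_lt_of_forall_lt hν hr

theorem isSplit_sum {μ : P ⊕ Q → ℕ} (hω : Function.Injective ω) (hν : Function.Injective ν)
    (h : IsDisjointUnionLabelling ω ν μ) : IsSplit ω ν μ Sum.inl Sum.inr where
  bijective := by
    rw [Sum.elim_inl_inr]
    exact Function.bijective_id
  le_left _ _ := Sum.inl_le_inl_iff
  le_right _ _ := Sum.inr_le_inr_iff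
  lt_left := lt_iff_lt_of_forall_lt hω h.left
  lt_right := lt_iff_lt_of_forall_lt hν h.right

end LabelledPoset

end

theorem mainTheorem4 {P Q : Type*} [PartialOrder P] [PartialOrder Q] (ω : P → ℕ) (ν : Q → ℕ)
    (hP : LabelledPoset.InClassI ω) (hQ : LabelledPoset.InClassI ν) :
    (∀ μ : P ⊕ₗ Q → ℕ, LabelledPoset.IsOrdinalSumLabelling₀ ω ν μ → LabelledPoset.InClassI μ) ∧
    (∀ μ : P ⊕ₗ Q → ℕ, LabelledPoset.IsOrdinalSumLabelling₁ ω ν μ → LabelledPoset.InClassI μ) ∧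
    (∀ μ : P ⊕ Q → ℕ, LabelledPoset.IsDisjointUnionLabelling ω ν μ → LabelledPoset.InClassI μ) := by
  have := hP.finite
  have := hQ.finite
  refine ⟨fun μ h => ?_, fun μ h => ?_, fun μ h => ?_⟩
  · exact (LabelledPoset.isSplit_lex hP.injective hQ.injective h.left h.right).inClassI_ordinal_weak
      h.injective hP hQ (fun a b => Sum.Lex.inl_le_inr a b) (fun _ _ => Sum.Lex.not_inr_le_inl)
      h.left_lt_right
  · exact (LabelledPoset.isSplit_lex hP.injective hQ.injective h.left
      h.right).inClassI_ordinal_strict h.injective hP hQ (fun a b => Sum.Lex.inl_le_inr a b)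
      (fun _ _ => Sum.Lex.not_inr_le_inl) fun a b => h.right_lt_left b a
  · exact (LabelledPoset.isSplit_sum hP.injective hQ.injective h).inClassI_disjoint h.injective
      hP hQ (fun _ _ => Sum.not_inl_le_inr) fun _ _ => Sum.not_inr_le_inl
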